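/- **Conventions.** 2-categories and 2-functors are strict. A 2-functor is *fully faithful* if it induces isomorphisms (not merely equivalences) of hom-categories. Its *essential image* is the full sub-2-category of its codomain on the objects isomorphic to an object in its image. Two 2-categories are *equivalent* if there are 2-functors in both directions whose composites are 2-naturally isomorphic to the identities. Fix universes $\mathcal U_1\in\mathcal U_2\in\mathcal U_3$; "large" means "in $\mathcal U_2$", and $\mathbf{SET}$ is the category of large sets. Let $\mathcal M=(\mathcal M,I,\otimes)$ be a large monoidal category. In what follows, natural families are dinatural (extranatural) in every variable that occurs twice in the domain only or twice in the codomain only. **Enrichments.** An *enrichment* over $\mathcal M$ is a large category $\mathcal C$ with a functor $\langle-,-\rangle\colon\mathcal C^{\mathrm{op}}\times\mathcal C\to\mathcal M$ and natural families $j_C\colon I\to\langle C,C\rangle$ and $M_{A,B,C}\colon\langle B,C\rangle\otimes\langle A,B\rangle\to\langle A,C\rangle$ satisfying the two unit laws and the associativity law. A 1-cell is a functor $G\colon\mathcal C\to\mathcal C'$ with a natural family $g_{A,B}\colon\langle A,B\rangle\to\langle GA,GB\rangle'$ such that $g_{C,C}\circ j_C=j'_{GC}$ and $g_{A,C}\circ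 M_{A,B,C}=M'_{GA,GB,GC}\circ(g_{B,C}\otimes g_{A,B})$. A 2-cell $(G,g)\Rightarrow(G',g')$ is a natural transformation $\theta\colon G\Rightarrow G'$ with $\langle GA,\theta_B\rangle'\circ g_{A,B}=\langle\theta_A,G'B\rangle'\circ g'_{A,B}$. These form a 2-category $\mathrm{Enrich}(\mathcal M)$. Let $\mathrm{Enrich}_r(\mathcal M)$ be its full sub-2-category on the enrichments such that $\langle C,-\rangle\colon\mathcal C\to\mathcal M$ is a right adjoint for every $C\in\mathcal C$. **Oplax actions.** An *oplax action* of $\mathcal M$ is a large category $\mathcal C$ with a functor $\ast\colon\mathcal M\times\mathcal C\to\mathcal C$ and natural families $\varepsilon_C\colon I\ast C\to C$ and $\delta_{X,Y,C}\colon(Y\otimes X)\ast C\to Y\ast(X\ast C)$ such that, up to the structural isomorphisms of $\mathcal M$, $\varepsilon_{X\ast C}\circ\delta_{X,I,C}=\mathrm{id}$, $(X\ast\varepsilon_C)\circ\delta_{I,X,C}=\mathrm{id}$ and $\delta_{Y,Z,X\ast C}\circ\delta_{X,Z\otimes Y,C}=(Z\ast\delta_{X,Y,C})\circ\delta_{Y\otimes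 X,Z,C}$. A 1-cell is a functor $G\colon\mathcal C\to\mathcal C'$ with a natural family $g_{X,C}\colon X\ast'GC\to G(X\ast C)$ such that $G\varepsilon_C\circ g_{I,C}=\varepsilon'_{GC}$ and $G\delta_{X,Y,C}\circ g_{Y\otimes X,C}=g_{Y,X\ast C}\circ(Y\ast'g_{X,C})\circ\delta'_{X,Y,GC}$. A 2-cell $(G,g)\Rightarrow(G',g')$ is a natural transformation $\theta\colon G\Rightarrow G'$ with $\theta_{X\ast C}\circ g_{X,C}=g'_{X,C}\circ(X\ast'\theta_C)$. These form a 2-category $\mathrm{OplaxAct}(\mathcal M)$. Let $\mathrm{OplaxAct}_l(\mathcal M)$ be its full sub-2-category on the oplax actions such that $-\ast C\colon\mathcal M\to\mathcal C$ is a left adjoint for every $C\in\mathcal C$. **Metamodels.** A *metamodel* of $\mathcal M$ is a large category $\mathcal C$ with a functor $\Phi\colon\mathcal M^{\mathrm{op}}\times\mathcal C^{\mathrm{op}}\times\mathcal C\to\mathbf{SET}$, $(X,A,B)\mapsto\Phi_X(A,B)$, and natural families of elements $(\overline\phi_\cdot)_C\in\Phi_I(C,C)$ and of functions $(\overline\phi_{X,Y})_{A,B,C}\colon\Phi_Y(B,C)\times\Phi_X(A,B)\to\Phi_{Y\otimes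 X}(A,C)$ that are unital and associative up to the structural isomorphisms of $\mathcal M$. A 1-cell is a functor $G\colon\mathcal C\to\mathcal C'$ with a natural family of functions $g_{X,A,B}\colon\Phi_X(A,B)\to\Phi'_X(GA,GB)$ compatible with $\overline\phi_\cdot$ and $\overline\phi$. A 2-cell $(G,g)\Rightarrow(G',g')$ is a natural transformation $\theta\colon G\Rightarrow G'$ with $\Phi'_X(GA,\theta_B)\circ g_{X,A,B}=\Phi'_X(\theta_A,G'B)\circ g'_{X,A,B}$. These form a 2-category $\mathrm{MtMod}(\mathcal M)$. **The 2-functors.** There are canonical 2-functors $\mathrm{Enrich}(\mathcal M)\to\mathrm{MtMod}(\mathcal M)$ and $\mathrm{OplaxAct}(\mathcal M)\to\mathrm{MtMod}(\mathcal M)$ that keep the underlying categories, functors and natural transformations. The first sends an enrichment to $\Phi_X(A,B)=\mathcal M(X,\langle A,B\rangle)$ with $(\overline\phi_\cdot)_C=j_C$ and $(g,f)\mapsto M_{A,B,C}\circ(g\otimes f)$, and sends $(G,g)$ to $G$ together with the functions $f\mapsto g_{A,B}\circ f$. The second sends an oplax action to $\Phi_X(A,B)=\mathcal C(X\ast A,B)$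 with $(\overline\phi_\cdot)_C=\varepsilon_C$ and $(g,f)\mapsto g\circ(Y\ast f)\circ\delta_{X,Y,A}$, and sends $(G,g)$ to $G$ together with the functions $f\mapsto Gf\circ g_{X,A}$. **Statement.** Let $\mathcal M$ be a large monoidal category. 1. The two 2-functors above restrict to fully faithful 2-functors $$\mathrm{Enrich}_r(\mathcal M)\longrightarrow\mathrm{MtMod}(\mathcal M),\qquad \mathrm{OplaxAct}_l(\mathcal M)\longrightarrow\mathrm{MtMod}(\mathcal M)$$ with the same essential image: a metamodel $(\mathcal C,\Phi,\overline\phi_\cdot,\overline\phi)$ lies in it if and only if for all $X\in\mathcal M$ and $A,B\in\mathcal C$ the functors $\Phi_{(-)}(A,B)\colon\mathcal M^{\mathrm{op}}\to\mathbf{SET}$ and $\Phi_X(A,-)\colon\mathcal C\to\mathbf{SET}$ are representable. 2. The 2-categories $\mathrm{Enrich}_r(\mathcal M)$ and $\mathrm{OplaxAct}_l(\mathcal M)$ are equivalent. -/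

import Mathlib

open CategoryTheory MonoidalCategory Opposite
open scoped Bicategory

universe w v u w₁ w₂ v₁ v₂ u₁ u₂

namespace Metatheory

/-! ### 2-categorical notions

A 2-category is a bicategory `B` with `[Bicategory.Strict B]`, and a 2-functor is a
`StrictPseudofunctor`. In a strict bicategory the objects and 1-cells form a category, so
`a ≅ b` denotes an isomorphism (not merely an equivalence) between objects of a 2-category. -/

section TwoCategories

variable {B : Type u₁} [Bicategory.{w₁, v₁} B] [Bicategory.Strict B]
  {C : Type u₂} [Bicategory.{w₂, v₂} C] [Bicategory.Strict C]

/-- A 2-functor is fully faithful if it induces isomorphisms of hom-categories, that is,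
if it is bijective on 1-cells and on 2-cells. -/
def IsFullyFaithful (F : StrictPseudofunctor B C) : Prop :=
  (∀ a b : B, Function.Bijective (fun f : a ⟶ b => F.map f)) ∧
    ∀ (a b : B) (f g : a ⟶ b), Function.Bijective (fun η : f ⟶ g => F.map₂ η)

/-- An object `c` is in the essential image of a 2-functor `F` if there is an isomorphism
`F a ≅ c` for some object `a`. -/
def InEssImage (F : StrictPseudofunctor B C) (c : C) : Prop :=
  ∃ a : B, Nonempty (F.obj a ≅ c)

/-- 2-natural isomorphisms between 2-functors. -/
structure TwoNatIso (F G : StrictPseudofunctor B C) where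
  app (a : B) : F.obj a ≅ G.obj a
  naturality {a b : B} (f : a ⟶ b) : F.map f ≫ (app b).hom = (app a).hom ≫ G.map f
  naturality₂ {a b : B} {f g : a ⟶ b} (η : f ⟶ g) :
    F.map₂ η ▷ (app b).hom =
      eqToHom (naturality f) ≫ (app a).hom ◁ G.map₂ η ≫ eqToHom (naturality g).symm

variable (B C) in
/-- Equivalences of 2-categories: 2-functors in both directions that are mutually inverse up to
2-natural isomorphism. -/
structure TwoEquivalence where
  functor : StrictPseudofunctor B C
  inverse : StrictPseudofunctor C B
  unitIso : TwoNatIso (StrictPseudofunctor.id B) (functor.comp inverse)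
  counitIso : TwoNatIso (inverse.comp functor) (StrictPseudofunctor.id C)

/-- The full sub-2-category of `B` on the objects satisfying `P`. -/
abbrev FullSub (P : B → Prop) : Type u₁ :=
  Bicategory.InducedBicategory B (Subtype.val : {b : B // P b} → B)

/-- The restriction of a 2-functor to a full sub-2-category. -/
abbrev restrict (P : B → Prop) (F : StrictPseudofunctor B C) :
    StrictPseudofunctor (FullSub P) C :=
  StrictPseudofunctor.comp Bicategory.InducedBicategory.forget F

end TwoCategories

section Bifunctors

variable {M : Type u} [Category.{v} M] {C : Type w} [Category.{v} C] (H : Cᵒᵖ ⥤ C ⥤ M)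

/-- The value `H(A, B)`. -/
abbrev ev (A B : C) : M := (H.obj (op A)).obj B

/-- `H(A, f) : H(A, B) ⟶ H(A, B')`. -/
abbrev post (A : C) {B B' : C} (f : B ⟶ B') : ev H A B ⟶ ev H A B' := (H.obj (op A)).map f

/-- `H(f, B) : H(A', B) ⟶ H(A, B)`. -/
abbrev pre {A A' : C} (f : A ⟶ A') (B : C) : ev H A' B ⟶ ev H A B := (H.map f.op).app B

@[simp] lemma post_id (A B : C) : post H A (𝟙 B) = 𝟙 _ := (H.obj (op A)).map_id B

@[simp] lemma pre_id (A B : C) : pre H (𝟙 A) B = 𝟙 _ := by simp [pre]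

lemma post_comp (A : C) {B B' B'' : C} (f : B ⟶ B') (g : B' ⟶ B'') :
    post H A (f ≫ g) = post H A f ≫ post H A g := (H.obj (op A)).map_comp f g

lemma pre_comp {A A' A'' : C} (f : A ⟶ A') (g : A' ⟶ A'') (B : C) :
    pre H (f ≫ g) B = pre H g B ≫ pre H f B := by simp [pre]

lemma post_pre {A A' B B' : C} (f : A ⟶ A') (g : B ⟶ B') :
    post H A' g ≫ pre H f B' = pre H f B ≫ post H A g := by simp [pre, post]

end Bifunctors

variable (M : Type u) [Category.{v} M] [MonoidalCategory M]

/-! ### Enrichments -/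

/-- An enrichment `(C, ⟨-,-⟩, j, M)` over the monoidal category `M`. -/
structure Enrichment where
  carrier : Type w
  [cat : Category.{v} carrier]
  hom : carrierᵒᵖ ⥤ carrier ⥤ M
  j (C : carrier) : 𝟙_ M ⟶ ev hom C C
  comp (A B C : carrier) : ev hom B C ⊗ ev hom A B ⟶ ev hom A C
  j_natural {C D : carrier} (f : C ⟶ D) : j C ≫ post hom C f = j D ≫ pre hom f D
  comp_natural_left {A A' : carrier} (f : A ⟶ A') (B C : carrier) :
    (ev hom B C ◁ pre hom f B) ≫ comp A B C = comp A' B C ≫ pre hom f C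
  comp_natural_middle (A : carrier) {B B' : carrier} (f : B ⟶ B') (C : carrier) :
    (ev hom B' C ◁ post hom A f) ≫ comp A B' C = (pre hom f C ▷ ev hom A B) ≫ comp A B C
  comp_natural_right (A B : carrier) {C C' : carrier} (f : C ⟶ C') :
    (post hom B f ▷ ev hom A B) ≫ comp A B C' = comp A B C ≫ post hom A f
  id_comp (A B : carrier) : (j B ▷ ev hom A B) ≫ comp A B B = (λ_ (ev hom A B)).hom
  comp_id (A B : carrier) : (ev hom A B ◁ j A) ≫ comp A A B = (ρ_ (ev hom A B)).hom
  assoc (A B C D : carrier) :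
    (comp B C D ▷ ev hom A B) ≫ comp A B D =
      (α_ (ev hom C D) (ev hom B C) (ev hom A B)).hom ≫
        (ev hom C D ◁ comp A B C) ≫ comp A C D

attribute [instance] Enrichment.cat

namespace Enrichment

variable {M}

/-- A 1-cell `(G, g)` between enrichments. -/
@[ext]
structure Hom (E E' : Enrichment.{w} M) where
  functor : E.carrier ⥤ E'.carrier
  app (A B : E.carrier) : ev E.hom A B ⟶ ev E'.hom (functor.obj A) (functor.obj B)
  natural_left {A A' : E.carrier} (f : A ⟶ A') (B : E.carrier) :
    pre E.hom f B ≫ app A B = app A' B ≫ pre E'.hom (functor.map f) (functor.obj B)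
  natural_right (A : E.carrier) {B B' : E.carrier} (f : B ⟶ B') :
    post E.hom A f ≫ app A B' = app A B ≫ post E'.hom (functor.obj A) (functor.map f)
  j_app (C : E.carrier) : E.j C ≫ app C C = E'.j (functor.obj C)
  comp_app (A B C : E.carrier) :
    E.comp A B C ≫ app A C =
      (app B C ⊗ₘ app A B) ≫ E'.comp (functor.obj A) (functor.obj B) (functor.obj C)

/-- A 2-cell between 1-cells of enrichments. -/
@[ext]
structure Hom₂ {E E' : Enrichment.{w} M} (F G : Hom E E') where
  nat : F.functor ⟶ G.functor
  comm (A B : E.carrier) :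
    F.app A B ≫ post E'.hom (F.functor.obj A) (nat.app B) =
      G.app A B ≫ pre E'.hom (nat.app A) (G.functor.obj B)

instance : CategoryStruct (Enrichment.{w} M) where
  Hom := Hom
  id E :=
    { functor := 𝟭 _
      app := fun A B => 𝟙 _
      natural_left := by intros; simp
      natural_right := by intros; simp
      j_app := by intros; simp
      comp_app := by intros; simp }
  comp F G :=
    { functor := F.functor ⋙ G.functor
      app := fun A B => F.app A B ≫ G.app _ _
      natural_left := fun f B => by
        rw [← Category.assoc, F.natural_left, Category.assoc, G.natural_left, Category.assoc]; rfl
      natural_right := fun A _ _ f => by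
        rw [← Category.assoc, F.natural_right, Category.assoc, G.natural_right, Category.assoc]
        rfl
      j_app := fun C => by rw [← Category.assoc, F.j_app, G.j_app]; rfl
      comp_app := fun A B C => by
        rw [← Category.assoc, F.comp_app, Category.assoc, G.comp_app, ← Category.assoc,
          tensorHom_comp_tensorHom]; rfl }

instance (E E' : Enrichment.{w} M) : Category (E ⟶ E') where
  Hom F G := Hom₂ F G
  id F := { nat := 𝟙 _, comm := by intros; simp }
  comp {F G K} η θ :=
    { nat := η.nat ≫ θ.nat
      comm := fun A B => by
        rw [NatTrans.comp_app, NatTrans.comp_app, post_comp, pre_comp, ← Category.assoc, η.comm,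
          Category.assoc, ← post_pre, ← Category.assoc, θ.comm, Category.assoc] }
  id_comp η := Hom₂.ext (Category.id_comp _)
  comp_id η := Hom₂.ext (Category.comp_id _)
  assoc η θ κ := Hom₂.ext (Category.assoc _ _ _)

@[simp] lemma id_functor (E : Enrichment.{w} M) : Hom.functor (𝟙 E) = 𝟭 _ := rfl

@[simp] lemma id_app (E : Enrichment.{w} M) (A B : E.carrier) :
    Hom.app (𝟙 E) A B = 𝟙 (ev E.hom A B) := rfl

@[simp] lemma comp_functor {E₁ E₂ E₃ : Enrichment.{w} M} (F : E₁ ⟶ E₂) (G : E₂ ⟶ E₃) :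
    Hom.functor (F ≫ G) = F.functor ⋙ G.functor := rfl

@[simp] lemma comp_app' {E₁ E₂ E₃ : Enrichment.{w} M} (F : E₁ ⟶ E₂) (G : E₂ ⟶ E₃)
    (A B : E₁.carrier) :
    Hom.app (F ≫ G) A B = F.app A B ≫ G.app (F.functor.obj A) (F.functor.obj B) := rfl

@[simp] lemma id_nat {E E' : Enrichment.{w} M} (F : E ⟶ E') :
    Hom₂.nat (𝟙 F) = 𝟙 F.functor := rfl

@[simp] lemma comp_nat {E E' : Enrichment.{w} M} {F G K : E ⟶ E'} (η : F ⟶ G) (θ : G ⟶ K) :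
    Hom₂.nat (η ≫ θ) = η.nat ≫ θ.nat := rfl

@[ext] lemma hom₂_ext {E E' : Enrichment.{w} M} {F G : E ⟶ E'} {η θ : F ⟶ G}
    (h : ∀ A, η.nat.app A = θ.nat.app A) : η = θ :=
  Hom₂.ext (NatTrans.ext (funext h))

protected lemma id_comp' {E E' : Enrichment.{w} M} (F : E ⟶ E') : 𝟙 E ≫ F = F :=
  Hom.ext rfl (heq_of_eq (by funext A B; exact Category.id_comp _))

protected lemma comp_id' {E E' : Enrichment.{w} M} (F : E ⟶ E') : F ≫ 𝟙 E' = F :=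
  Hom.ext rfl (heq_of_eq (by funext A B; exact Category.comp_id _))

protected lemma assoc' {E₁ E₂ E₃ E₄ : Enrichment.{w} M} (F : E₁ ⟶ E₂) (G : E₂ ⟶ E₃)
    (K : E₃ ⟶ E₄) : (F ≫ G) ≫ K = F ≫ G ≫ K :=
  Hom.ext rfl (heq_of_eq (by funext A B; exact Category.assoc _ _ _))

lemma eqToHom_nat_app {E E' : Enrichment.{w} M} {F G : E ⟶ E'} (h : F = G) (A : E.carrier) :
    (Hom₂.nat (eqToHom h)).app A = eqToHom (by rw [h]) := by
  subst h; rfl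

/-- Left whiskering: the whiskering of natural transformations. -/
def whiskerLeft {E₁ E₂ E₃ : Enrichment.{w} M} (F : E₁ ⟶ E₂) {G K : E₂ ⟶ E₃} (η : G ⟶ K) :
    F ≫ G ⟶ F ≫ K where
  nat := Functor.whiskerLeft F.functor η.nat
  comm A B := by
    have h := η.comm (F.functor.obj A) (F.functor.obj B)
    simp only [comp_app', comp_functor, Functor.whiskerLeft_app, Functor.comp_obj,
      Category.assoc]
    rw [h]

/-- Right whiskering: the whiskering of natural transformations. -/
def whiskerRight {E₁ E₂ E₃ : Enrichment.{w} M} {F G : E₁ ⟶ E₂} (η : F ⟶ G) (K : E₂ ⟶ E₃) :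
    F ≫ K ⟶ G ≫ K where
  nat := Functor.whiskerRight η.nat K.functor
  comm A B := by
    simp only [comp_app', comp_functor, Functor.whiskerRight_app, Functor.comp_obj,
      Category.assoc]
    rw [← K.natural_right, ← Category.assoc, η.comm, Category.assoc, K.natural_left]

@[simp] lemma whiskerLeft_app {E₁ E₂ E₃ : Enrichment.{w} M} (F : E₁ ⟶ E₂) {G K : E₂ ⟶ E₃}
    (η : G ⟶ K) (A : E₁.carrier) :
    (whiskerLeft F η).nat.app A = η.nat.app (F.functor.obj A) := rfl

@[simp] lemma whiskerRight_app {E₁ E₂ E₃ : Enrichment.{w} M} {F G : E₁ ⟶ E₂} (η : F ⟶ G)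
    (K : E₂ ⟶ E₃) (A : E₁.carrier) :
    (whiskerRight η K).nat.app A = K.functor.map (η.nat.app A) := rfl

/-- The 2-category of enrichments over `M`. Horizontal composition is that of functors and natural
transformations. -/
instance : Bicategory (Enrichment.{w} M) where
  whiskerLeft F _ _ η := whiskerLeft F η
  whiskerRight η K := whiskerRight η K
  associator F G K := eqToIso (Enrichment.assoc' F G K)
  leftUnitor F := eqToIso (Enrichment.id_comp' F)
  rightUnitor F := eqToIso (Enrichment.comp_id' F)
  id_whiskerLeft := by intros; ext; simp [eqToHom_nat_app]
  comp_whiskerLeft := by intros; ext; simp [eqToHom_nat_app]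
  whiskerRight_id := by intros; ext; simp [eqToHom_nat_app]
  whiskerRight_comp := by intros; ext; simp [eqToHom_nat_app]
  whisker_assoc := by intros; ext; simp [eqToHom_nat_app]
  pentagon := by intros; ext; simp [eqToHom_nat_app]
  triangle := by intros; ext; simp [eqToHom_nat_app]

instance : Bicategory.Strict (Enrichment.{w} M) where
  id_comp := Enrichment.id_comp'
  comp_id := Enrichment.comp_id'
  assoc := Enrichment.assoc'

end Enrichment

/-! ### Oplax actions -/

section Actions

variable {M : Type u} [Category.{v} M] {C : Type w} [Category.{v} C] (T : M ⥤ C ⥤ C)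

/-- The value `X ∗ C`. -/
abbrev act (X : M) (A : C) : C := (T.obj X).obj A

/-- `u ∗ A : X ∗ A ⟶ Y ∗ A`. -/
abbrev actL {X Y : M} (p : X ⟶ Y) (A : C) : act T X A ⟶ act T Y A := (T.map p).app A

/-- `X ∗ f : X ∗ A ⟶ X ∗ B`. -/
abbrev actR (X : M) {A B : C} (f : A ⟶ B) : act T X A ⟶ act T X B := (T.obj X).map f

@[simp] lemma actR_id (X : M) (A : C) : actR T X (𝟙 A) = 𝟙 _ := (T.obj X).map_id A

lemma actR_comp (X : M) {A B D : C} (f : A ⟶ B) (g : B ⟶ D) :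
    actR T X (f ≫ g) = actR T X f ≫ actR T X g := (T.obj X).map_comp f g

@[simp] lemma actL_id (X : M) (A : C) : actL T (𝟙 X) A = 𝟙 _ := by simp [actL]

lemma actL_comp {X Y Z : M} (p : X ⟶ Y) (q : Y ⟶ Z) (A : C) :
    actL T (p ≫ q) A = actL T p A ≫ actL T q A := by simp [actL]

lemma actL_actR {X Y : M} (p : X ⟶ Y) {A B : C} (f : A ⟶ B) :
    actL T p A ≫ actR T Y f = actR T X f ≫ actL T p B := by simp [actL, actR]

end Actions

/-- An oplax action `(C, ∗, ε, δ)` of the monoidal category `M`. -/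
structure OplaxAction where
  carrier : Type w
  [cat : Category.{v} carrier]
  T : M ⥤ carrier ⥤ carrier
  eps (A : carrier) : act T (𝟙_ M) A ⟶ A
  delta (X Y : M) (A : carrier) : act T (Y ⊗ X) A ⟶ act T Y (act T X A)
  eps_natural {A B : carrier} (f : A ⟶ B) : actR T (𝟙_ M) f ≫ eps B = eps A ≫ f
  delta_natural_left {X X' : M} (p : X ⟶ X') (Y : M) (A : carrier) :
    actL T (Y ◁ p) A ≫ delta X' Y A = delta X Y A ≫ actR T Y (actL T p A)
  delta_natural_middle (X : M) {Y Y' : M} (p : Y ⟶ Y') (A : carrier) :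
    actL T (p ▷ X) A ≫ delta X Y' A = delta X Y A ≫ actL T p (act T X A)
  delta_natural_right (X Y : M) {A B : carrier} (f : A ⟶ B) :
    actR T (Y ⊗ X) f ≫ delta X Y B = delta X Y A ≫ actR T Y (actR T X f)
  delta_unit_left (X : M) (A : carrier) :
    delta X (𝟙_ M) A ≫ eps (act T X A) = actL T (λ_ X).hom A
  delta_unit_right (X : M) (A : carrier) :
    delta (𝟙_ M) X A ≫ actR T X (eps A) = actL T (ρ_ X).hom A
  delta_assoc (X Y Z : M) (A : carrier) :
    delta X (Z ⊗ Y) A ≫ delta Y Z (act T X A) =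
      actL T (α_ Z Y X).hom A ≫ delta (Y ⊗ X) Z A ≫ actR T Z (delta X Y A)

attribute [instance] OplaxAction.cat

namespace OplaxAction

variable {M}

/-- A 1-cell `(G, g)` between oplax actions. -/
@[ext]
structure Hom (E E' : OplaxAction.{w} M) where
  functor : E.carrier ⥤ E'.carrier
  app (X : M) (A : E.carrier) : act E'.T X (functor.obj A) ⟶ functor.obj (act E.T X A)
  natural_left {X Y : M} (p : X ⟶ Y) (A : E.carrier) :
    actL E'.T p (functor.obj A) ≫ app Y A = app X A ≫ functor.map (actL E.T p A)
  natural_right (X : M) {A B : E.carrier} (f : A ⟶ B) :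
    actR E'.T X (functor.map f) ≫ app X B = app X A ≫ functor.map (actR E.T X f)
  app_eps (A : E.carrier) : app (𝟙_ M) A ≫ functor.map (E.eps A) = E'.eps (functor.obj A)
  app_delta (X Y : M) (A : E.carrier) :
    app (Y ⊗ X) A ≫ functor.map (E.delta X Y A) =
      E'.delta X Y (functor.obj A) ≫ actR E'.T Y (app X A) ≫ app Y (act E.T X A)

/-- A 2-cell between 1-cells of oplax actions. -/
@[ext]
structure Hom₂ {E E' : OplaxAction.{w} M} (F G : Hom E E') where
  nat : F.functor ⟶ G.functor
  comm (X : M) (A : E.carrier) :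
    F.app X A ≫ nat.app (act E.T X A) = actR E'.T X (nat.app A) ≫ G.app X A

instance : CategoryStruct (OplaxAction.{w} M) where
  Hom := Hom
  id E :=
    { functor := 𝟭 _
      app := fun X A => 𝟙 _
      natural_left := by intros; simp
      natural_right := by intros; simp
      app_eps := by intros; simp
      app_delta := by intros; simp }
  comp F G :=
    { functor := F.functor ⋙ G.functor
      app := fun X A => G.app X (F.functor.obj A) ≫ G.functor.map (F.app X A)
      natural_left := fun p A => by
        have h := G.natural_left p (F.functor.obj A)
        simp only [Functor.comp_obj, Functor.comp_map, Category.assoc]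
        rw [reassoc_of% h, ← Functor.map_comp, ← Functor.map_comp, F.natural_left]
      natural_right := fun X A B f => by
        have h := G.natural_right X (F.functor.map f)
        simp only [Functor.comp_obj, Functor.comp_map, Category.assoc]
        rw [reassoc_of% h, ← Functor.map_comp, ← Functor.map_comp, F.natural_right]
      app_eps := fun A => by
        simp only [Functor.comp_obj, Functor.comp_map, Category.assoc]
        rw [← Functor.map_comp, F.app_eps, G.app_eps]
      app_delta := fun X Y A => by
        have h := G.app_delta X Y (F.functor.obj A)
        have h' := G.natural_right Y (F.app X A)
        simp only [Functor.comp_obj, Functor.comp_map, Category.assoc, actR_comp]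
        rw [← Functor.map_comp, F.app_delta, Functor.map_comp, Functor.map_comp, reassoc_of% h,
          reassoc_of% h'] }

instance (E E' : OplaxAction.{w} M) : Category (E ⟶ E') where
  Hom F G := Hom₂ F G
  id F := { nat := 𝟙 _, comm := by intros; simp }
  comp {F G K} η θ :=
    { nat := η.nat ≫ θ.nat
      comm := fun X A => by
        rw [NatTrans.comp_app, NatTrans.comp_app, actR_comp, ← Category.assoc, η.comm,
          Category.assoc, θ.comm, Category.assoc] }
  id_comp η := Hom₂.ext (Category.id_comp _)
  comp_id η := Hom₂.ext (Category.comp_id _)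
  assoc η θ κ := Hom₂.ext (Category.assoc _ _ _)

@[simp] lemma id_functor (E : OplaxAction.{w} M) : Hom.functor (𝟙 E) = 𝟭 _ := rfl

@[simp] lemma comp_functor {E₁ E₂ E₃ : OplaxAction.{w} M} (F : E₁ ⟶ E₂) (G : E₂ ⟶ E₃) :
    Hom.functor (F ≫ G) = F.functor ⋙ G.functor := rfl

@[simp] lemma id_nat {E E' : OplaxAction.{w} M} (F : E ⟶ E') :
    Hom₂.nat (𝟙 F) = 𝟙 F.functor := rfl

@[simp] lemma comp_nat {E E' : OplaxAction.{w} M} {F G K : E ⟶ E'} (η : F ⟶ G) (θ : G ⟶ K) :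
    Hom₂.nat (η ≫ θ) = η.nat ≫ θ.nat := rfl

@[ext] lemma hom₂_ext {E E' : OplaxAction.{w} M} {F G : E ⟶ E'} {η θ : F ⟶ G}
    (h : ∀ A, η.nat.app A = θ.nat.app A) : η = θ :=
  Hom₂.ext (NatTrans.ext (funext h))

@[simp] lemma id_app (E : OplaxAction.{w} M) (X : M) (A : E.carrier) :
    Hom.app (𝟙 E) X A = 𝟙 (act E.T X A) := rfl

@[simp] lemma comp_app {E₁ E₂ E₃ : OplaxAction.{w} M} (F : E₁ ⟶ E₂) (G : E₂ ⟶ E₃)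
    (X : M) (A : E₁.carrier) :
    Hom.app (F ≫ G) X A = G.app X (F.functor.obj A) ≫ G.functor.map (F.app X A) := rfl

protected lemma id_comp' {E E' : OplaxAction.{w} M} (F : E ⟶ E') : 𝟙 E ≫ F = F :=
  Hom.ext rfl (heq_of_eq (by
    funext X A
    exact (congrArg (F.app X A ≫ ·) (F.functor.map_id _)).trans (Category.comp_id _)))

protected lemma comp_id' {E E' : OplaxAction.{w} M} (F : E ⟶ E') : F ≫ 𝟙 E' = F :=
  Hom.ext rfl (heq_of_eq (by funext X A; exact Category.id_comp _))

protected lemma assoc' {E₁ E₂ E₃ E₄ : OplaxAction.{w} M} (F : E₁ ⟶ E₂) (G : E₂ ⟶ E₃)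
    (K : E₃ ⟶ E₄) : (F ≫ G) ≫ K = F ≫ G ≫ K :=
  Hom.ext rfl (heq_of_eq (by funext X A; simp))

/-- Left whiskering: the whiskering of natural transformations. -/
def whiskerLeft {E₁ E₂ E₃ : OplaxAction.{w} M} (F : E₁ ⟶ E₂) {G K : E₂ ⟶ E₃} (η : G ⟶ K) :
    F ≫ G ⟶ F ≫ K where
  nat := Functor.whiskerLeft F.functor η.nat
  comm X A := by
    have h := η.comm X (F.functor.obj A)
    simp only [comp_app, comp_functor, Functor.whiskerLeft_app, Functor.comp_obj,
      Category.assoc]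
    rw [η.nat.naturality, reassoc_of% h]

/-- Right whiskering: the whiskering of natural transformations. -/
def whiskerRight {E₁ E₂ E₃ : OplaxAction.{w} M} {F G : E₁ ⟶ E₂} (η : F ⟶ G) (K : E₂ ⟶ E₃) :
    F ≫ K ⟶ G ≫ K where
  nat := Functor.whiskerRight η.nat K.functor
  comm X A := by
    have h := K.natural_right X (η.nat.app A)
    simp only [comp_app, comp_functor, Functor.whiskerRight_app, Functor.comp_obj,
      Category.assoc]
    rw [← Functor.map_comp, η.comm, Functor.map_comp, reassoc_of% h]

lemma eqToHom_nat_app {E E' : OplaxAction.{w} M} {F G : E ⟶ E'} (h : F = G) (A : E.carrier) :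
    (Hom₂.nat (eqToHom h)).app A = eqToHom (by rw [h]) := by
  subst h; rfl

@[simp] lemma whiskerLeft_app {E₁ E₂ E₃ : OplaxAction.{w} M} (F : E₁ ⟶ E₂) {G K : E₂ ⟶ E₃}
    (η : G ⟶ K) (A : E₁.carrier) :
    (whiskerLeft F η).nat.app A = η.nat.app (F.functor.obj A) := rfl

@[simp] lemma whiskerRight_app {E₁ E₂ E₃ : OplaxAction.{w} M} {F G : E₁ ⟶ E₂} (η : F ⟶ G)
    (K : E₂ ⟶ E₃) (A : E₁.carrier) :
    (whiskerRight η K).nat.app A = K.functor.map (η.nat.app A) := rfl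

/-- The 2-category of oplax actions of `M`. Horizontal composition is that of functors and natural
transformations. -/
instance : Bicategory (OplaxAction.{w} M) where
  whiskerLeft F _ _ η := whiskerLeft F η
  whiskerRight η K := whiskerRight η K
  associator F G K := eqToIso (OplaxAction.assoc' F G K)
  leftUnitor F := eqToIso (OplaxAction.id_comp' F)
  rightUnitor F := eqToIso (OplaxAction.comp_id' F)
  id_whiskerLeft := by intros; ext; simp [eqToHom_nat_app]
  comp_whiskerLeft := by intros; ext; simp [eqToHom_nat_app]
  whiskerRight_id := by intros; ext; simp [eqToHom_nat_app]
  whiskerRight_comp := by intros; ext; simp [eqToHom_nat_app]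
  whisker_assoc := by intros; ext; simp [eqToHom_nat_app]
  pentagon := by intros; ext; simp [eqToHom_nat_app]
  triangle := by intros; ext; simp [eqToHom_nat_app]

instance : Bicategory.Strict (OplaxAction.{w} M) where
  id_comp := OplaxAction.id_comp'
  comp_id := OplaxAction.comp_id'
  assoc := OplaxAction.assoc'

end OplaxAction

/-! ### Metamodels -/

section Trifunctors

variable {M : Type u} [Category.{v} M] {C : Type w} [Category.{v} C]
  (Φ : Mᵒᵖ ⥤ Cᵒᵖ ⥤ C ⥤ Type v)

/-- The set `Φ_X(A, B)`. -/
abbrev val (X : M) (A B : C) : Type v := ((Φ.obj (op X)).obj (op A)).obj B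

/-- The function `Φ_p(A, B) : Φ_Y(A, B) → Φ_X(A, B)`. -/
abbrev mapM {X Y : M} (p : X ⟶ Y) (A B : C) (x : val Φ Y A B) : val Φ X A B :=
  ((Φ.map p.op).app (op A)).app B x

/-- The function `Φ_X(f, B) : Φ_X(A', B) → Φ_X(A, B)`. -/
abbrev mapL (X : M) {A A' : C} (f : A ⟶ A') (B : C) (x : val Φ X A' B) : val Φ X A B :=
  ((Φ.obj (op X)).map f.op).app B x

/-- The function `Φ_X(A, f) : Φ_X(A, B) → Φ_X(A, B')`. -/
abbrev mapR (X : M) (A : C) {B B' : C} (f : B ⟶ B') (x : val Φ X A B) : val Φ X A B' :=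
  ((Φ.obj (op X)).obj (op A)).map f x

@[simp] lemma mapL_id (X : M) (A B : C) (x : val Φ X A B) : mapL Φ X (𝟙 A) B x = x := by
  simp [mapL]

@[simp] lemma mapR_id (X : M) (A B : C) (x : val Φ X A B) : mapR Φ X A (𝟙 B) x = x := by
  simp [mapR]

lemma mapL_comp (X : M) {A A' A'' : C} (f : A ⟶ A') (g : A' ⟶ A'') (B : C)
    (x : val Φ X A'' B) : mapL Φ X (f ≫ g) B x = mapL Φ X f B (mapL Φ X g B x) := by
  simp [mapL]

lemma mapR_comp (X : M) (A : C) {B B' B'' : C} (f : B ⟶ B') (g : B' ⟶ B'')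
    (x : val Φ X A B) : mapR Φ X A (f ≫ g) x = mapR Φ X A g (mapR Φ X A f x) := by
  simp [mapR]

lemma mapL_mapR (X : M) {A A' B B' : C} (f : A ⟶ A') (g : B ⟶ B') (x : val Φ X A' B) :
    mapL Φ X f B' (mapR Φ X A' g x) = mapR Φ X A g (mapL Φ X f B x) :=
  NatTrans.naturality_apply ((Φ.obj (op X)).map f.op) g x

end Trifunctors

/-- A metamodel `(C, Φ, φ_·, φ)` of the monoidal category `M`. A function from the singleton to
`Φ_I(A, A)` is given as the element `unit A`. -/
structure Metamodel where
  carrier : Type w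
  [cat : Category.{v} carrier]
  Φ : Mᵒᵖ ⥤ carrierᵒᵖ ⥤ carrier ⥤ Type v
  unit (A : carrier) : val Φ (𝟙_ M) A A
  mul (X Y : M) (A B C : carrier) (y : val Φ Y B C) (x : val Φ X A B) : val Φ (Y ⊗ X) A C
  unit_natural {A B : carrier} (f : A ⟶ B) :
    mapR Φ (𝟙_ M) A f (unit A) = mapL Φ (𝟙_ M) f B (unit B)
  mul_natural_X {X X' : M} (p : X ⟶ X') (Y : M) (A B C : carrier)
    (y : val Φ Y B C) (x : val Φ X' A B) :
    mul X Y A B C y (mapM Φ p A B x) = mapM Φ (Y ◁ p) A C (mul X' Y A B C y x)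
  mul_natural_Y (X : M) {Y Y' : M} (p : Y ⟶ Y') (A B C : carrier)
    (y : val Φ Y' B C) (x : val Φ X A B) :
    mul X Y A B C (mapM Φ p B C y) x = mapM Φ (p ▷ X) A C (mul X Y' A B C y x)
  mul_natural_left (X Y : M) {A A' : carrier} (f : A ⟶ A') (B C : carrier)
    (y : val Φ Y B C) (x : val Φ X A' B) :
    mul X Y A B C y (mapL Φ X f B x) = mapL Φ (Y ⊗ X) f C (mul X Y A' B C y x)
  mul_natural_middle (X Y : M) (A : carrier) {B B' : carrier} (f : B ⟶ B') (C : carrier)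
    (y : val Φ Y B' C) (x : val Φ X A B) :
    mul X Y A B' C y (mapR Φ X A f x) = mul X Y A B C (mapL Φ Y f C y) x
  mul_natural_right (X Y : M) (A B : carrier) {C C' : carrier} (f : C ⟶ C')
    (y : val Φ Y B C) (x : val Φ X A B) :
    mul X Y A B C' (mapR Φ Y B f y) x = mapR Φ (Y ⊗ X) A f (mul X Y A B C y x)
  unit_mul (X : M) (A B : carrier) (x : val Φ X A B) :
    mul X (𝟙_ M) A B B (unit B) x = mapM Φ (λ_ X).hom A B x
  mul_unit (X : M) (A B : carrier) (x : val Φ X A B) :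
    mul (𝟙_ M) X A A B x (unit A) = mapM Φ (ρ_ X).hom A B x
  mul_assoc (X Y Z : M) (A B C D : carrier)
    (z : val Φ Z C D) (y : val Φ Y B C) (x : val Φ X A B) :
    mul X (Z ⊗ Y) A B D (mul Y Z B C D z y) x =
      mapM Φ (α_ Z Y X).hom A D (mul (Y ⊗ X) Z A C D z (mul X Y A B C y x))

attribute [instance] Metamodel.cat

namespace Metamodel

variable {M}

/-- A 1-cell `(G, g)` between metamodels. -/
@[ext]
structure Hom (E E' : Metamodel.{w} M) where
  functor : E.carrier ⥤ E'.carrier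
  app (X : M) (A B : E.carrier) (x : val E.Φ X A B) :
    val E'.Φ X (functor.obj A) (functor.obj B)
  natural_M {X Y : M} (p : X ⟶ Y) (A B : E.carrier) (x : val E.Φ Y A B) :
    app X A B (mapM E.Φ p A B x) = mapM E'.Φ p _ _ (app Y A B x)
  natural_left (X : M) {A A' : E.carrier} (f : A ⟶ A') (B : E.carrier) (x : val E.Φ X A' B) :
    app X A B (mapL E.Φ X f B x) = mapL E'.Φ X (functor.map f) _ (app X A' B x)
  natural_right (X : M) (A : E.carrier) {B B' : E.carrier} (f : B ⟶ B') (x : val E.Φ X A B) :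
    app X A B' (mapR E.Φ X A f x) = mapR E'.Φ X _ (functor.map f) (app X A B x)
  app_unit (A : E.carrier) : app (𝟙_ M) A A (E.unit A) = E'.unit (functor.obj A)
  app_mul (X Y : M) (A B C : E.carrier) (y : val E.Φ Y B C) (x : val E.Φ X A B) :
    app (Y ⊗ X) A C (E.mul X Y A B C y x) =
      E'.mul X Y _ _ _ (app Y B C y) (app X A B x)

/-- A 2-cell between 1-cells of metamodels. -/
@[ext]
structure Hom₂ {E E' : Metamodel.{w} M} (F G : Hom E E') where
  nat : F.functor ⟶ G.functor
  comm (X : M) (A B : E.carrier) (x : val E.Φ X A B) :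
    mapR E'.Φ X _ (nat.app B) (F.app X A B x) = mapL E'.Φ X (nat.app A) _ (G.app X A B x)

instance : CategoryStruct (Metamodel.{w} M) where
  Hom := Hom
  id E :=
    { functor := 𝟭 _
      app := fun X A B x => x
      natural_M := fun _ _ _ _ => rfl
      natural_left := fun _ _ _ _ _ _ => rfl
      natural_right := fun _ _ _ _ _ _ => rfl
      app_unit := fun _ => rfl
      app_mul := fun _ _ _ _ _ _ _ => rfl }
  comp F G :=
    { functor := F.functor ⋙ G.functor
      app := fun X A B x => G.app X _ _ (F.app X A B x)
      natural_M := fun p A B x => by rw [F.natural_M, G.natural_M]; rfl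
      natural_left := fun X _ _ f B x => by rw [F.natural_left, G.natural_left]; rfl
      natural_right := fun X A _ _ f x => by rw [F.natural_right, G.natural_right]; rfl
      app_unit := fun A => by rw [F.app_unit, G.app_unit]; rfl
      app_mul := fun X Y A B C y x => by rw [F.app_mul, G.app_mul]; rfl }

instance (E E' : Metamodel.{w} M) : Category (E ⟶ E') where
  Hom F G := Hom₂ F G
  id F := { nat := 𝟙 _, comm := by intros; simp }
  comp {F G K} η θ :=
    { nat := η.nat ≫ θ.nat
      comm := fun X A B x => by
        rw [NatTrans.comp_app, NatTrans.comp_app, mapR_comp, mapL_comp, η.comm, ← mapL_mapR,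
          θ.comm] }
  id_comp η := Hom₂.ext (Category.id_comp _)
  comp_id η := Hom₂.ext (Category.comp_id _)
  assoc η θ κ := Hom₂.ext (Category.assoc _ _ _)

@[simp] lemma id_functor (E : Metamodel.{w} M) : Hom.functor (𝟙 E) = 𝟭 _ := rfl

@[simp] lemma comp_functor {E₁ E₂ E₃ : Metamodel.{w} M} (F : E₁ ⟶ E₂) (G : E₂ ⟶ E₃) :
    Hom.functor (F ≫ G) = F.functor ⋙ G.functor := rfl

@[simp] lemma id_nat {E E' : Metamodel.{w} M} (F : E ⟶ E') :
    Hom₂.nat (𝟙 F) = 𝟙 F.functor := rfl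

@[simp] lemma comp_nat {E E' : Metamodel.{w} M} {F G K : E ⟶ E'} (η : F ⟶ G) (θ : G ⟶ K) :
    Hom₂.nat (η ≫ θ) = η.nat ≫ θ.nat := rfl

@[ext] lemma hom₂_ext {E E' : Metamodel.{w} M} {F G : E ⟶ E'} {η θ : F ⟶ G}
    (h : ∀ A, η.nat.app A = θ.nat.app A) : η = θ :=
  Hom₂.ext (NatTrans.ext (funext h))

@[simp] lemma id_app (E : Metamodel.{w} M) (X : M) (A B : E.carrier) (x : val E.Φ X A B) :
    Hom.app (𝟙 E) X A B x = x := rfl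

@[simp] lemma comp_app {E₁ E₂ E₃ : Metamodel.{w} M} (F : E₁ ⟶ E₂) (G : E₂ ⟶ E₃)
    (X : M) (A B : E₁.carrier) (x : val E₁.Φ X A B) :
    Hom.app (F ≫ G) X A B x = G.app X _ _ (F.app X A B x) := rfl

protected lemma id_comp' {E E' : Metamodel.{w} M} (F : E ⟶ E') : 𝟙 E ≫ F = F := rfl

protected lemma comp_id' {E E' : Metamodel.{w} M} (F : E ⟶ E') : F ≫ 𝟙 E' = F := rfl

protected lemma assoc' {E₁ E₂ E₃ E₄ : Metamodel.{w} M} (F : E₁ ⟶ E₂) (G : E₂ ⟶ E₃)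
    (K : E₃ ⟶ E₄) : (F ≫ G) ≫ K = F ≫ G ≫ K := rfl

/-- Left whiskering: the whiskering of natural transformations. -/
def whiskerLeft {E₁ E₂ E₃ : Metamodel.{w} M} (F : E₁ ⟶ E₂) {G K : E₂ ⟶ E₃} (η : G ⟶ K) :
    F ≫ G ⟶ F ≫ K where
  nat := Functor.whiskerLeft F.functor η.nat
  comm X A B x := η.comm X _ _ (F.app X A B x)

/-- Right whiskering: the whiskering of natural transformations. -/
def whiskerRight {E₁ E₂ E₃ : Metamodel.{w} M} {F G : E₁ ⟶ E₂} (η : F ⟶ G) (K : E₂ ⟶ E₃) :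
    F ≫ K ⟶ G ≫ K where
  nat := Functor.whiskerRight η.nat K.functor
  comm X A B x := by
    have h := congrArg (K.app X _ _) (η.comm X A B x)
    rw [K.natural_right, K.natural_left] at h
    exact h

lemma eqToHom_nat_app {E E' : Metamodel.{w} M} {F G : E ⟶ E'} (h : F = G) (A : E.carrier) :
    (Hom₂.nat (eqToHom h)).app A = eqToHom (by rw [h]) := by
  subst h; rfl

@[simp] lemma whiskerLeft_app {E₁ E₂ E₃ : Metamodel.{w} M} (F : E₁ ⟶ E₂) {G K : E₂ ⟶ E₃}
    (η : G ⟶ K) (A : E₁.carrier) :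
    (whiskerLeft F η).nat.app A = η.nat.app (F.functor.obj A) := rfl

@[simp] lemma whiskerRight_app {E₁ E₂ E₃ : Metamodel.{w} M} {F G : E₁ ⟶ E₂} (η : F ⟶ G)
    (K : E₂ ⟶ E₃) (A : E₁.carrier) :
    (whiskerRight η K).nat.app A = K.functor.map (η.nat.app A) := rfl

/-- The 2-category of metamodels of `M`. Horizontal composition is that of functors and natural
transformations. -/
instance : Bicategory (Metamodel.{w} M) where
  whiskerLeft F _ _ η := whiskerLeft F η
  whiskerRight η K := whiskerRight η K
  associator F G K := eqToIso (Metamodel.assoc' F G K)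
  leftUnitor F := eqToIso (Metamodel.id_comp' F)
  rightUnitor F := eqToIso (Metamodel.comp_id' F)
  id_whiskerLeft := by intros; ext; simp
  comp_whiskerLeft := by intros; ext; simp
  whiskerRight_id := by intros; ext; simp
  whiskerRight_comp := by intros; ext; simp
  whisker_assoc := by intros; ext; simp
  pentagon := by intros; ext; simp
  triangle := by intros; ext; simp

instance : Bicategory.Strict (Metamodel.{w} M) where
  id_comp := Metamodel.id_comp'
  comp_id := Metamodel.comp_id'
  assoc := Metamodel.assoc'

end Metamodel

/-! ### The embeddings into metamodels -/

variable {M}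

namespace Enrichment

/-- The functor `(X, A, B) ↦ M(X, ⟨A, B⟩)`. -/
def toΦ {C : Type w} [Category.{v} C] (H : Cᵒᵖ ⥤ C ⥤ M) : Mᵒᵖ ⥤ Cᵒᵖ ⥤ C ⥤ Type v where
  obj X := H ⋙ (Functor.whiskeringRight C M (Type v)).obj (coyoneda.obj X)
  map p := Functor.whiskerLeft H ((Functor.whiskeringRight C M (Type v)).map (coyoneda.map p))

section

variable (E : Enrichment.{w} M) {A B C D : E.carrier} {X Y Z : M}

/-- The multiplication of the induced metamodel, sending `g : Y ⟶ ⟨B, C⟩` and `f : X ⟶ ⟨A, B⟩` to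
the composite `Y ⊗ X ⟶ ⟨B, C⟩ ⊗ ⟨A, B⟩ ⟶ ⟨A, C⟩`. -/
def mul (g : Y ⟶ ev E.hom B C) (f : X ⟶ ev E.hom A B) : Y ⊗ X ⟶ ev E.hom A C :=
  (g ⊗ₘ f) ≫ E.comp A B C

lemma mul_natural_X {X' : M} (p : X ⟶ X') (g : Y ⟶ ev E.hom B C) (f : X' ⟶ ev E.hom A B) :
    E.mul g (p ≫ f) = Y ◁ p ≫ E.mul g f := by
  simp [mul, MonoidalCategory.tensorHom_def']

lemma mul_natural_Y {Y' : M} (p : Y ⟶ Y') (g : Y' ⟶ ev E.hom B C) (f : X ⟶ ev E.hom A B) :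
    E.mul (p ≫ g) f = p ▷ X ≫ E.mul g f := by
  simp [mul, MonoidalCategory.tensorHom_def]

lemma mul_natural_left {A' : E.carrier} (p : A ⟶ A') (g : Y ⟶ ev E.hom B C)
    (f : X ⟶ ev E.hom A' B) :
    E.mul g (f ≫ pre E.hom p B) = E.mul g f ≫ pre E.hom p C := by
  rw [mul, mul, Category.assoc, ← E.comp_natural_left]
  simp [MonoidalCategory.tensorHom_def]

lemma mul_natural_middle {B' : E.carrier} (p : B ⟶ B') (g : Y ⟶ ev E.hom B' C)
    (f : X ⟶ ev E.hom A B) :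
    E.mul g (f ≫ post E.hom A p) = E.mul (g ≫ pre E.hom p C) f := by
  have h := E.comp_natural_middle A p C
  have h1 : g ⊗ₘ (f ≫ post E.hom A p) = (g ⊗ₘ f) ≫ (_ ◁ post E.hom A p) := by
    simp [MonoidalCategory.tensorHom_def]
  have h2 : (g ≫ pre E.hom p C) ⊗ₘ f = (g ⊗ₘ f) ≫ (pre E.hom p C ▷ _) := by
    simp [MonoidalCategory.tensorHom_def']
  rw [mul, mul, h1, h2, Category.assoc, h, Category.assoc]

lemma mul_natural_right {C' : E.carrier} (p : C ⟶ C') (g : Y ⟶ ev E.hom B C)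
    (f : X ⟶ ev E.hom A B) :
    E.mul (g ≫ post E.hom B p) f = E.mul g f ≫ post E.hom A p := by
  rw [mul, mul, Category.assoc, ← E.comp_natural_right]
  simp [MonoidalCategory.tensorHom_def']

lemma unit_mul (f : X ⟶ ev E.hom A B) : E.mul (E.j B) f = (λ_ X).hom ≫ f := by
  rw [mul, MonoidalCategory.tensorHom_def', Category.assoc, E.id_comp,
    MonoidalCategory.leftUnitor_naturality]

lemma mul_unit (f : X ⟶ ev E.hom A B) : E.mul f (E.j A) = (ρ_ X).hom ≫ f := by
  rw [mul, MonoidalCategory.tensorHom_def, Category.assoc, E.comp_id,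
    MonoidalCategory.rightUnitor_naturality]

lemma mul_assoc (h : Z ⟶ ev E.hom C D) (g : Y ⟶ ev E.hom B C) (f : X ⟶ ev E.hom A B) :
    E.mul (E.mul h g) f = (α_ Z Y X).hom ≫ E.mul h (E.mul g f) := by
  have e := E.assoc A B C D
  have h1 : ((h ⊗ₘ g) ≫ E.comp B C D) ⊗ₘ f =
      ((h ⊗ₘ g) ⊗ₘ f) ≫ (E.comp B C D ▷ ev E.hom A B) := by
    simp [MonoidalCategory.tensorHom_def']
  have h2 : h ⊗ₘ ((g ⊗ₘ f) ≫ E.comp A B C) =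
      (h ⊗ₘ (g ⊗ₘ f)) ≫ (ev E.hom C D ◁ E.comp A B C) := by
    simp [MonoidalCategory.tensorHom_def]
  simp only [mul]
  rw [h1, h2, Category.assoc, e, MonoidalCategory.associator_naturality_assoc, Category.assoc]

end

/-- The metamodel induced by an enrichment. -/
def toMetamodel (E : Enrichment.{w} M) : Metamodel.{w} M where
  carrier := E.carrier
  Φ := toΦ E.hom
  unit A := E.j A
  mul _ _ _ _ _ g f := E.mul g f
  unit_natural f := E.j_natural f
  mul_natural_X p _ _ _ _ g f := E.mul_natural_X p g f
  mul_natural_Y _ _ _ p _ _ _ g f := E.mul_natural_Y p g f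
  mul_natural_left _ _ _ _ p _ _ g f := E.mul_natural_left p g f
  mul_natural_middle _ _ _ _ _ p _ g f := E.mul_natural_middle p g f
  mul_natural_right _ _ _ _ _ _ p g f := E.mul_natural_right p g f
  unit_mul _ _ _ f := E.unit_mul f
  mul_unit _ _ _ f := E.mul_unit f
  mul_assoc _ _ _ _ _ _ _ h g f := E.mul_assoc h g f

section

variable {E E' : Enrichment.{w} M} (F : E ⟶ E') {A B C : E.carrier} {X Y : M}

/-- The function `M(X, ⟨A, B⟩) → M(X, ⟨G A, G B⟩')` induced by a 1-cell `(G, g)`. -/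
def trans (f : X ⟶ ev E.hom A B) : X ⟶ ev E'.hom (F.functor.obj A) (F.functor.obj B) :=
  f ≫ F.app A B

lemma trans_natural_left {A' : E.carrier} (p : A ⟶ A') (f : X ⟶ ev E.hom A' B) :
    trans F (f ≫ pre E.hom p B) = trans F f ≫ pre E'.hom (F.functor.map p) (F.functor.obj B) := by
  rw [trans, trans, Category.assoc, Category.assoc, F.natural_left]

lemma trans_natural_right {B' : E.carrier} (p : B ⟶ B') (f : X ⟶ ev E.hom A B) :
    trans F (f ≫ post E.hom A p) =
      trans F f ≫ post E'.hom (F.functor.obj A) (F.functor.map p) := by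
  rw [trans, trans, Category.assoc, Category.assoc, F.natural_right]

lemma trans_mul (g : Y ⟶ ev E.hom B C) (f : X ⟶ ev E.hom A B) :
    trans F (E.mul g f) = E'.mul (trans F g) (trans F f) := by
  simp only [trans, mul]
  rw [Category.assoc, F.comp_app, ← MonoidalCategory.tensorHom_comp_tensorHom, Category.assoc]

lemma trans_comm {F G : E ⟶ E'} (θ : F ⟶ G) (f : X ⟶ ev E.hom A B) :
    trans F f ≫ post E'.hom (F.functor.obj A) (θ.nat.app B) =
      trans G f ≫ pre E'.hom (θ.nat.app A) (G.functor.obj B) := by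
  rw [trans, trans, Category.assoc, Category.assoc, θ.comm]

end

/-- The action of the embedding on 1-cells: `(G, g)` is sent to
`(G, (M(X, g_{A,B}))_{X,A,B})`. -/
def mapHom {E E' : Enrichment.{w} M} (F : E ⟶ E') : E.toMetamodel ⟶ E'.toMetamodel where
  functor := F.functor
  app _ _ _ f := trans F f
  natural_M p _ _ f := Category.assoc p f _
  natural_left _ _ _ p _ f := trans_natural_left F p f
  natural_right _ _ _ _ p f := trans_natural_right F p f
  app_unit A := F.j_app A
  app_mul _ _ _ _ _ g f := trans_mul F g f

/-- The action of the embedding on 2-cells: `θ` is sent to `θ`. -/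
def mapHom₂ {E E' : Enrichment.{w} M} {F G : E ⟶ E'} (θ : F ⟶ G) : mapHom F ⟶ mapHom G where
  nat := θ.nat
  comm _ _ _ f := trans_comm θ f

lemma mapHom_id (E : Enrichment.{w} M) : mapHom (𝟙 E) = 𝟙 E.toMetamodel :=
  Metamodel.Hom.ext rfl (heq_of_eq (by funext X A B f; exact Category.comp_id _))

lemma mapHom_comp {E₁ E₂ E₃ : Enrichment.{w} M} (F : E₁ ⟶ E₂) (G : E₂ ⟶ E₃) :
    mapHom (F ≫ G) = mapHom F ≫ mapHom G :=
  Metamodel.Hom.ext rfl (heq_of_eq (by funext X A B f; exact (Category.assoc _ _ _).symm))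

variable (M) in
/-- The 2-functor from enrichments to metamodels. -/
def toMetamodelFunctor : StrictPseudofunctor (Enrichment.{w} M) (Metamodel.{w} M) :=
  StrictPseudofunctor.mk''
    { obj := toMetamodel
      map := mapHom
      map₂ := mapHom₂
      map₂_id := fun _ => rfl
      map₂_comp := fun _ _ => rfl
      map_id := mapHom_id
      map_comp := mapHom_comp
      map₂_whisker_left := fun F G K η => by
        apply Metamodel.hom₂_ext
        intro A
        simp only [Metamodel.comp_nat, NatTrans.comp_app, Metamodel.eqToHom_nat_app]
        erw [Category.comp_id, Category.id_comp]
        rfl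
      map₂_whisker_right := fun η K => by
        apply Metamodel.hom₂_ext
        intro A
        simp only [Metamodel.comp_nat, NatTrans.comp_app, Metamodel.eqToHom_nat_app]
        erw [Category.comp_id, Category.id_comp]
        rfl }

end Enrichment

namespace OplaxAction

/-- The functor `(X, A, B) ↦ C(X ∗ A, B)`. -/
def toΦ {C : Type w} [Category.{v} C] (T : M ⥤ C ⥤ C) : Mᵒᵖ ⥤ Cᵒᵖ ⥤ C ⥤ Type v where
  obj X := (T.obj X.unop).op ⋙ coyoneda
  map p := Functor.whiskerRight (NatTrans.op (T.map p.unop)) coyoneda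

section

variable (E : OplaxAction.{w} M) {A B C D : E.carrier} {X Y Z : M}

/-- The multiplication of the induced metamodel, sending `g : Y ∗ B ⟶ C` and `f : X ∗ A ⟶ B` to
the composite `(Y ⊗ X) ∗ A ⟶ Y ∗ (X ∗ A) ⟶ Y ∗ B ⟶ C`. -/
def mul (g : act E.T Y B ⟶ C) (f : act E.T X A ⟶ B) : act E.T (Y ⊗ X) A ⟶ C :=
  E.delta X Y A ≫ actR E.T Y f ≫ g

lemma mul_natural_X {X' : M} (p : X ⟶ X') (g : act E.T Y B ⟶ C) (f : act E.T X' A ⟶ B) :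
    E.mul g (actL E.T p A ≫ f) = actL E.T (Y ◁ p) A ≫ E.mul g f := by
  have h := E.delta_natural_left p Y A
  rw [mul, mul, reassoc_of% h, actR_comp, Category.assoc]

lemma mul_natural_Y {Y' : M} (p : Y ⟶ Y') (g : act E.T Y' B ⟶ C) (f : act E.T X A ⟶ B) :
    E.mul (actL E.T p B ≫ g) f = actL E.T (p ▷ X) A ≫ E.mul g f := by
  have h := E.delta_natural_middle X p A
  have h' := actL_actR E.T p f
  rw [mul, mul, reassoc_of% h, reassoc_of% h']

lemma mul_natural_left {A' : E.carrier} (p : A ⟶ A') (g : act E.T Y B ⟶ C)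
    (f : act E.T X A' ⟶ B) :
    E.mul g (actR E.T X p ≫ f) = actR E.T (Y ⊗ X) p ≫ E.mul g f := by
  have h := E.delta_natural_right X Y p
  rw [mul, mul, reassoc_of% h, actR_comp, Category.assoc]

lemma mul_natural_middle {B' : E.carrier} (p : B ⟶ B') (g : act E.T Y B' ⟶ C)
    (f : act E.T X A ⟶ B) : E.mul g (f ≫ p) = E.mul (actR E.T Y p ≫ g) f := by
  rw [mul, mul, actR_comp, Category.assoc]

lemma mul_natural_right {C' : E.carrier} (p : C ⟶ C') (g : act E.T Y B ⟶ C)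
    (f : act E.T X A ⟶ B) : E.mul (g ≫ p) f = E.mul g f ≫ p := by
  simp only [mul, Category.assoc]

lemma unit_mul (f : act E.T X A ⟶ B) :
    E.mul (E.eps B) f = actL E.T (λ_ X).hom A ≫ f := by
  rw [mul, E.eps_natural, ← Category.assoc, E.delta_unit_left]

lemma mul_unit (f : act E.T X A ⟶ B) :
    E.mul f (E.eps A) = actL E.T (ρ_ X).hom A ≫ f := by
  rw [mul, ← Category.assoc, E.delta_unit_right]

lemma mul_assoc (h : act E.T Z C ⟶ D) (g : act E.T Y B ⟶ C) (f : act E.T X A ⟶ B) :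
    E.mul (E.mul h g) f = actL E.T (α_ Z Y X).hom A ≫ E.mul h (E.mul g f) := by
  have h1 := E.delta_natural_right Y Z f
  have h2 := E.delta_assoc X Y Z A
  simp only [mul]
  rw [reassoc_of% h1, reassoc_of% h2]
  simp only [actR_comp, Category.assoc]

end

/-- The metamodel induced by an oplax action. -/
def toMetamodel (E : OplaxAction.{w} M) : Metamodel.{w} M where
  carrier := E.carrier
  Φ := toΦ E.T
  unit A := E.eps A
  mul _ _ _ _ _ g f := E.mul g f
  unit_natural f := (E.eps_natural f).symm
  mul_natural_X p _ _ _ _ g f := E.mul_natural_X p g f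
  mul_natural_Y _ _ _ p _ _ _ g f := E.mul_natural_Y p g f
  mul_natural_left _ _ _ _ p _ _ g f := E.mul_natural_left p g f
  mul_natural_middle _ _ _ _ _ p _ g f := E.mul_natural_middle p g f
  mul_natural_right _ _ _ _ _ _ p g f := E.mul_natural_right p g f
  unit_mul _ _ _ f := E.unit_mul f
  mul_unit _ _ _ f := E.mul_unit f
  mul_assoc _ _ _ _ _ _ _ h g f := E.mul_assoc h g f

section

variable {E E' : OplaxAction.{w} M} (F : E ⟶ E') {A B C : E.carrier} {X Y : M}

/-- The function `C(X ∗ A, B) → C'(X ∗' G A, G B)` induced by a 1-cell `(G, g)`. -/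
def trans (f : act E.T X A ⟶ B) : act E'.T X (F.functor.obj A) ⟶ F.functor.obj B :=
  F.app X A ≫ F.functor.map f

lemma trans_natural_M (p : X ⟶ Y) (f : act E.T Y A ⟶ B) :
    trans F (actL E.T p A ≫ f) = actL E'.T p (F.functor.obj A) ≫ trans F f := by
  have h := F.natural_left p A
  rw [trans, trans, reassoc_of% h, Functor.map_comp]

lemma trans_natural_left {A' : E.carrier} (p : A ⟶ A') (f : act E.T X A' ⟶ B) :
    trans F (actR E.T X p ≫ f) = actR E'.T X (F.functor.map p) ≫ trans F f := by
  have h := F.natural_right X p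
  rw [trans, trans, reassoc_of% h, Functor.map_comp]

lemma trans_natural_right {B' : E.carrier} (p : B ⟶ B') (f : act E.T X A ⟶ B) :
    trans F (f ≫ p) = trans F f ≫ F.functor.map p := by
  rw [trans, trans, Functor.map_comp, Category.assoc]

lemma trans_mul (g : act E.T Y B ⟶ C) (f : act E.T X A ⟶ B) :
    trans F (E.mul g f) = E'.mul (trans F g) (trans F f) := by
  have h := F.app_delta X Y A
  have h' := F.natural_right Y f
  simp only [trans, mul]
  rw [Functor.map_comp, Functor.map_comp, reassoc_of% h, actR_comp, Category.assoc,
    reassoc_of% h']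

lemma trans_comm {F G : E ⟶ E'} (θ : F ⟶ G) (f : act E.T X A ⟶ B) :
    trans F f ≫ θ.nat.app B = actR E'.T X (θ.nat.app A) ≫ trans G f := by
  have h := θ.comm X A
  rw [trans, trans, ← reassoc_of% h, Category.assoc, θ.nat.naturality]

end

/-- The action of the embedding on 1-cells: `(G, g)` is sent to `G` with the functions
`C(X ∗ A, B) → C'(X ∗' G A, G B)`, `f ↦ G f ∘ g_{X,A}`. -/
def mapHom {E E' : OplaxAction.{w} M} (F : E ⟶ E') : E.toMetamodel ⟶ E'.toMetamodel where
  functor := F.functor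
  app _ _ _ f := trans F f
  natural_M p _ _ f := trans_natural_M F p f
  natural_left _ _ _ p _ f := trans_natural_left F p f
  natural_right _ _ _ _ p f := trans_natural_right F p f
  app_unit A := F.app_eps A
  app_mul _ _ _ _ _ g f := trans_mul F g f

/-- The action of the embedding on 2-cells: `θ` is sent to `θ`. -/
def mapHom₂ {E E' : OplaxAction.{w} M} {F G : E ⟶ E'} (θ : F ⟶ G) : mapHom F ⟶ mapHom G where
  nat := θ.nat
  comm _ _ _ f := trans_comm θ f

lemma mapHom_id (E : OplaxAction.{w} M) : mapHom (𝟙 E) = 𝟙 E.toMetamodel :=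
  Metamodel.Hom.ext rfl (heq_of_eq (by funext X A B f; exact Category.id_comp _))

lemma mapHom_comp {E₁ E₂ E₃ : OplaxAction.{w} M} (F : E₁ ⟶ E₂) (G : E₂ ⟶ E₃) :
    mapHom (F ≫ G) = mapHom F ≫ mapHom G :=
  Metamodel.Hom.ext rfl (heq_of_eq (by
    funext X A B f
    change (G.app X _ ≫ G.functor.map (F.app X A)) ≫ G.functor.map (F.functor.map f) =
      G.app X _ ≫ G.functor.map (F.app X A ≫ F.functor.map f)
    rw [Functor.map_comp, Category.assoc]))

variable (M) in
/-- The 2-functor from oplax actions to metamodels. -/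
def toMetamodelFunctor : StrictPseudofunctor (OplaxAction.{w} M) (Metamodel.{w} M) :=
  StrictPseudofunctor.mk''
    { obj := toMetamodel
      map := mapHom
      map₂ := mapHom₂
      map₂_id := fun _ => rfl
      map₂_comp := fun _ _ => rfl
      map_id := mapHom_id
      map_comp := mapHom_comp
      map₂_whisker_left := fun F G K η => by
        apply Metamodel.hom₂_ext
        intro A
        simp only [Metamodel.comp_nat, NatTrans.comp_app, Metamodel.eqToHom_nat_app]
        erw [Category.comp_id, Category.id_comp]
        rfl
      map₂_whisker_right := fun η K => by
        apply Metamodel.hom₂_ext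
        intro A
        simp only [Metamodel.comp_nat, NatTrans.comp_app, Metamodel.eqToHom_nat_app]
        erw [Category.comp_id, Category.id_comp]
        rfl }

end OplaxAction

/-! ### The full sub-2-categories and the representability condition -/

variable (M)

/-- The 2-category of enrichments over `M` such that each `⟨A, -⟩` is a right adjoint. -/
abbrev EnrichmentR :=
  FullSub fun E : Enrichment.{w} M => ∀ A : E.carrier, (E.hom.obj (op A)).IsRightAdjoint

/-- The 2-category of oplax actions of `M` such that each `- ∗ A` is a left adjoint. -/
abbrev OplaxActionL :=
  FullSub fun E : OplaxAction.{w} M => ∀ A : E.carrier, (E.T.flip.obj A).IsLeftAdjoint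

/-- The restriction to `EnrichmentR M` of the 2-functor from enrichments to metamodels. -/
abbrev enrichmentREmbedding : StrictPseudofunctor (EnrichmentR.{w} M) (Metamodel.{w} M) :=
  restrict _ (Enrichment.toMetamodelFunctor.{w} M)

/-- The restriction to `OplaxActionL M` of the 2-functor from oplax actions to metamodels. -/
abbrev oplaxActionLEmbedding : StrictPseudofunctor (OplaxActionL.{w} M) (Metamodel.{w} M) :=
  restrict _ (OplaxAction.toMetamodelFunctor.{w} M)

variable {M}

/-- All the functors `Φ_(-)(A, B)` and `Φ_X(A, -)` are representable. -/
def Metamodel.IsBirepresentable (P : Metamodel.{w} M) : Prop :=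
  ∀ (X : M) (A B : P.carrier),
    ((P.Φ.flip.obj (op A)).flip.obj B).IsRepresentable ∧
      ((P.Φ.obj (op X)).obj (op A)).IsCorepresentable

end Metatheory

/-! The theorem is the Yoneda lemma applied in two different variables. The metamodel of an
enrichment is representable in `X`, with universal element the identity of `⟨A, B⟩`; the metamodel
of an oplax action is corepresentable in `B`, with universal element the identity of `X ∗ A`. A
1-cell between such metamodels is therefore determined by its values on universal elements, and its
axioms, read there, are the axioms of a 1-cell of enrichments or of actions. On 2-cells both
embeddings keep the natural transformation. So both are fully faithful (`homEquiv`,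
`mapHom₂_bijective`) even without adjointness hypotheses.

Adjointness supplies exactly the missing representability: `⟨A, -⟩` has a left adjoint iff every
`M(X, ⟨A, -⟩)` is corepresentable, and dually for `- ∗ A` (`isBirepresentable_iff`). Conversely,
choosing representing objects of a birepresentable metamodel yields an enrichment (`HomRep`) and an
oplax action (`ActRep`) on the same category, each law being a metamodel axiom evaluated on
universal elements. The comparison with the given metamodel has the identity as underlying functor,
hence is an isomorphism and not just an equivalence. Since birepresentability is invariant under
isomorphism (`IsBirepresentable.of_iso`), it describes both essential images.

Two fully faithful 2-functors with the same essential image have equivalent domains: send an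
enrichment to an action with isomorphic metamodel, and conjugate 1-cells and 2-cells by the chosen
isomorphisms. -/

namespace Metatheory

/-! ### Interchange of the functoriality in `M` with the functoriality in `C`. -/

section Trifunctors

variable {M : Type u} [Category.{v} M] {C : Type w} [Category.{v} C] (Φ : Mᵒᵖ ⥤ Cᵒᵖ ⥤ C ⥤ Type v)

lemma mapM_mapR {X Y : M} (p : X ⟶ Y) (A : C) {B B' : C} (g : B ⟶ B') (x : val Φ Y A B) :
    mapM Φ p A B' (mapR Φ Y A g x) = mapR Φ X A g (mapM Φ p A B x) :=
  NatTrans.naturality_apply ((Φ.map p.op).app (op A)) g x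

lemma mapM_mapL {X Y : M} (p : X ⟶ Y) {A A' : C} (f : A ⟶ A') (B : C) (x : val Φ Y A' B) :
    mapM Φ p A B (mapL Φ Y f B x) = mapL Φ X f B (mapM Φ p A' B x) :=
  ConcreteCategory.congr_hom (NatTrans.congr_app ((Φ.map p.op).naturality f.op) B) x

end Trifunctors

variable {M : Type u} [Category.{v} M] [MonoidalCategory M]

/-! ### Full faithfulness -/

namespace Enrichment

/-- The 1-cell of enrichments induced by a 1-cell of the associated metamodels, obtained by
evaluation at identities. -/
def ofHom {E E' : Enrichment.{w} M} (H : E.toMetamodel ⟶ E'.toMetamodel) : E ⟶ E' :=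
  let app (A B : E.carrier) : ev E.hom A B ⟶ ev E'.hom (H.functor.obj A) (H.functor.obj B) :=
    H.app (ev E.hom A B) A B (𝟙 (ev E.hom A B))
  -- Yoneda: naturality in the variable of `M` carries the value at the identity to the value at any
  -- `f`. Every axiom below then becomes the corresponding axiom of `H` at identities.
  have key {X : M} {A B : E.carrier} (f : X ⟶ ev E.hom A B) : f ≫ app A B = H.app X A B f :=
    (H.natural_M f A B (𝟙 (ev E.hom A B))).symm.trans
      (congrArg (H.app X A B) (Category.comp_id f))
  { functor := H.functor
    app := app
    natural_left := fun {A A'} f B => (key _).trans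
      ((congrArg (H.app _ A B) (Category.id_comp (pre E.hom f B))).symm.trans
        (H.natural_left _ f B (𝟙 (ev E.hom A' B))))
    natural_right := fun A {B B'} f => (key _).trans
      ((congrArg (H.app _ A B') (Category.id_comp (post E.hom A f))).symm.trans
        (H.natural_right _ A f (𝟙 (ev E.hom A B))))
    j_app := fun A => (key _).trans (H.app_unit A)
    comp_app := fun A B C => by
      have h := H.app_mul _ _ A B C (𝟙 (ev E.hom B C)) (𝟙 (ev E.hom A B))
      -- The composition of the enrichment is the product of two universal elements in its
      -- metamodel.
      have h' : (𝟙 (ev E.hom B C) ⊗ₘ 𝟙 (ev E.hom A B)) ≫ E.comp A B C = E.comp A B C := by simp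
      exact (key _).trans ((congrArg (H.app _ A C) h').symm.trans h) }

lemma comp_ofHom_app {E E' : Enrichment.{w} M} (H : E.toMetamodel ⟶ E'.toMetamodel) {X : M}
    {A B : E.carrier} (f : X ⟶ ev E.hom A B) :
    f ≫ (ofHom H).app A B = H.app X A B f :=
  (H.natural_M f A B (𝟙 (ev E.hom A B))).symm.trans
    (congrArg (H.app X A B) (Category.comp_id f))

/-- 1-cells of enrichments are the same as 1-cells of the associated metamodels. -/
def homEquiv (E E' : Enrichment.{w} M) : (E ⟶ E') ≃ (E.toMetamodel ⟶ E'.toMetamodel) where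
  toFun := mapHom
  invFun := ofHom
  left_inv F := Hom.ext rfl (heq_of_eq (by funext A B; exact Category.id_comp _))
  right_inv H := Metamodel.Hom.ext rfl (heq_of_eq (by
    funext X A B f; exact comp_ofHom_app H f))

/-- The 2-cell of enrichments with the same underlying natural transformation as a given 2-cell of
metamodels. -/
def ofHom₂ {E E' : Enrichment.{w} M} {F G : E ⟶ E'} (θ : mapHom F ⟶ mapHom G) : F ⟶ G where
  nat := θ.nat
  comm A B := by
    have h : (𝟙 _ ≫ F.app A B) ≫ post E'.hom (F.functor.obj A) (θ.nat.app B) =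
      (𝟙 _ ≫ G.app A B) ≫ pre E'.hom (θ.nat.app A) (G.functor.obj B) :=
        θ.comm _ A B (𝟙 (ev E.hom A B))
    rwa [Category.id_comp, Category.id_comp] at h

/-- A 2-cell on either side is a natural transformation with a property, and the two properties
agree: one direction is composition, the other is evaluation at identities. -/
lemma mapHom₂_bijective {E E' : Enrichment.{w} M} (F G : E ⟶ E') :
    Function.Bijective (fun θ : F ⟶ G => mapHom₂ θ) :=
  Function.bijective_iff_has_inverse.2 ⟨ofHom₂, fun _ => rfl, fun _ => rfl⟩

end Enrichment

namespace OplaxAction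

/-- The 1-cell of oplax actions induced by a 1-cell of the associated metamodels, obtained by
evaluation at identities. -/
def ofHom {E E' : OplaxAction.{w} M} (H : E.toMetamodel ⟶ E'.toMetamodel) : E ⟶ E' :=
  let app (X : M) (A : E.carrier) : act E'.T X (H.functor.obj A) ⟶ H.functor.obj (act E.T X A) :=
    H.app X A (act E.T X A) (𝟙 (act E.T X A))
  -- Here the Yoneda argument uses naturality in the target `B`, the variable in which the metamodel
  -- of an action is corepresentable.
  have key {X : M} {A B : E.carrier} (f : act E.T X A ⟶ B) :
      app X A ≫ H.functor.map f = H.app X A B f :=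
    (H.natural_right X A f (𝟙 (act E.T X A))).symm.trans
      (congrArg (H.app X A B) (Category.id_comp f))
  { functor := H.functor
    app := app
    natural_left := fun {X Y} p A => ((key _).trans
      ((congrArg (H.app X A _) (Category.comp_id (actL E.T p A))).symm.trans
        (H.natural_M p A _ (𝟙 (act E.T Y A))))).symm
    natural_right := fun X {A B} f => ((key _).trans
      ((congrArg (H.app X A _) (Category.comp_id (actR E.T X f))).symm.trans
        (H.natural_left X f _ (𝟙 (act E.T X B))))).symm
    app_eps := fun A => (key _).trans (H.app_unit A)
    app_delta := fun X Y A => by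
      have h := H.app_mul X Y A _ _ (𝟙 (act E.T Y (act E.T X A))) (𝟙 (act E.T X A))
      -- `delta` is the product of two universal elements in the metamodel of the action.
      have h' : E.delta X Y A ≫ actR E.T Y (𝟙 (act E.T X A)) ≫ 𝟙 (act E.T Y (act E.T X A)) =
        E.delta X Y A := by simp
      exact (key _).trans ((congrArg (H.app _ A _) h').symm.trans h) }

lemma ofHom_app_comp {E E' : OplaxAction.{w} M} (H : E.toMetamodel ⟶ E'.toMetamodel) {X : M}
    {A B : E.carrier} (f : act E.T X A ⟶ B) :
    (ofHom H).app X A ≫ H.functor.map f = H.app X A B f :=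
  (H.natural_right X A f (𝟙 (act E.T X A))).symm.trans
    (congrArg (H.app X A B) (Category.id_comp f))

/-- 1-cells of oplax actions are the same as 1-cells of the associated metamodels. -/
def homEquiv (E E' : OplaxAction.{w} M) : (E ⟶ E') ≃ (E.toMetamodel ⟶ E'.toMetamodel) where
  toFun := mapHom
  invFun := ofHom
  left_inv F := Hom.ext rfl (heq_of_eq (by
    funext X A
    exact (congrArg (F.app X A ≫ ·) (F.functor.map_id _)).trans (Category.comp_id _)))
  right_inv H := Metamodel.Hom.ext rfl (heq_of_eq (by
    funext X A B f; exact ofHom_app_comp H f))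

/-- The 2-cell of oplax actions with the same underlying natural transformation as a given 2-cell of
metamodels. -/
def ofHom₂ {E E' : OplaxAction.{w} M} {F G : E ⟶ E'} (θ : mapHom F ⟶ mapHom G) : F ⟶ G where
  nat := θ.nat
  comm X A := by
    have h : (F.app X A ≫ F.functor.map (𝟙 _)) ≫ θ.nat.app (act E.T X A) =
      actR E'.T X (θ.nat.app A) ≫ G.app X A ≫ G.functor.map (𝟙 _) :=
        θ.comm X A _ (𝟙 (act E.T X A))
    erw [F.functor.map_id, G.functor.map_id, Category.comp_id, Category.comp_id] at h
    exact h

lemma mapHom₂_bijective {E E' : OplaxAction.{w} M} (F G : E ⟶ E') :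
    Function.Bijective (fun θ : F ⟶ G => mapHom₂ θ) :=
  Function.bijective_iff_has_inverse.2 ⟨ofHom₂, fun _ => rfl, fun _ => rfl⟩

end OplaxAction

/-- A restriction of a fully faithful 2-functor to a full sub-2-category is fully faithful. -/
lemma IsFullyFaithful.restrict {B : Type u₁} [Bicategory.{w₁, v₁} B] [Bicategory.Strict B]
    {C : Type u₂} [Bicategory.{w₂, v₂} C] [Bicategory.Strict C] {F : StrictPseudofunctor B C}
    (hF : IsFullyFaithful F) (P : B → Prop) : IsFullyFaithful (restrict P F) := by
  refine ⟨fun a b => ⟨fun f g h => ?_, fun f => ?_⟩, fun a b f g => ⟨fun η θ h => ?_, fun η => ?_⟩⟩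
  · exact Bicategory.InducedBicategory.hom_ext ((hF.1 _ _).1 h)
  · obtain ⟨g, hg⟩ := (hF.1 _ _).2 f
    exact ⟨Bicategory.InducedBicategory.mkHom g, hg⟩
  · exact Bicategory.InducedBicategory.hom₂_ext ((hF.2 _ _ _ _).1 h)
  · obtain ⟨θ, hθ⟩ := (hF.2 _ _ _ _).2 η
    exact ⟨⟨θ⟩, hθ⟩

lemma Enrichment.isFullyFaithful_toMetamodelFunctor :
    IsFullyFaithful (Enrichment.toMetamodelFunctor.{w} M) :=
  ⟨fun E E' => (homEquiv E E').bijective, fun _ _ F G => mapHom₂_bijective F G⟩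

lemma OplaxAction.isFullyFaithful_toMetamodelFunctor :
    IsFullyFaithful (OplaxAction.toMetamodelFunctor.{w} M) :=
  ⟨fun E E' => (homEquiv E E').bijective, fun _ _ F G => mapHom₂_bijective F G⟩

/-! ### Reconstruction from representations -/

namespace Metamodel

/-- A choice of representations of the functors `Φ_(-)(A, B)`. -/
structure HomRep (P : Metamodel.{w} M) where
  H : P.carrier → P.carrier → M
  e {X : M} {A B : P.carrier} : (X ⟶ H A B) ≃ val P.Φ X A B
  e_comp {X Y : M} {A B : P.carrier} (p : X ⟶ Y) (f : Y ⟶ H A B) :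
    e (p ≫ f) = mapM P.Φ p A B (e f)

namespace HomRep

variable {P : Metamodel.{w} M} (R : P.HomRep)

/-- The device for all laws of the reconstructed enrichment: equations of morphisms into `H A B` are
compared as elements of `Φ`, where the metamodel axioms apply. -/
lemma ext {X : M} {A B : P.carrier} {f g : X ⟶ R.H A B} (h : R.e f = R.e g) : f = g :=
  R.e.injective h

/-- The universal element of `Φ_(-)(A, B)`. -/
def univ (A B : P.carrier) : val P.Φ (R.H A B) A B := R.e (𝟙 _)

@[simp] lemma e_id (A B : P.carrier) : R.e (𝟙 (R.H A B)) = R.univ A B := rfl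

@[simp] lemma mapM_univ {X : M} {A B : P.carrier} (f : X ⟶ R.H A B) :
    mapM P.Φ f A B (R.univ A B) = R.e f := by
  rw [univ, ← R.e_comp, Category.comp_id]

/-- The contravariant functoriality of the representing objects. -/
def pre {A A' : P.carrier} (f : A ⟶ A') (B : P.carrier) : R.H A' B ⟶ R.H A B :=
  R.e.symm (mapL P.Φ _ f B (R.univ A' B))

/-- The covariant functoriality of the representing objects. -/
def post (A : P.carrier) {B B' : P.carrier} (f : B ⟶ B') : R.H A B ⟶ R.H A B' :=
  R.e.symm (mapR P.Φ _ A f (R.univ A B))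

/-- The composition on the representing objects. -/
def comp (A B C : P.carrier) : R.H B C ⊗ R.H A B ⟶ R.H A C :=
  R.e.symm (P.mul _ _ A B C (R.univ B C) (R.univ A B))

@[simp] lemma e_pre {A A' : P.carrier} (f : A ⟶ A') (B : P.carrier) :
    R.e (R.pre f B) = mapL P.Φ _ f B (R.univ A' B) := R.e.apply_symm_apply _

@[simp] lemma e_post (A : P.carrier) {B B' : P.carrier} (f : B ⟶ B') :
    R.e (R.post A f) = mapR P.Φ _ A f (R.univ A B) := R.e.apply_symm_apply _

@[simp] lemma e_comp' (A B C : P.carrier) :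
    R.e (R.comp A B C) = P.mul _ _ A B C (R.univ B C) (R.univ A B) := R.e.apply_symm_apply _

@[simp] lemma e_comp_pre {X : M} {A A' B : P.carrier} (x : X ⟶ R.H A' B) (f : A ⟶ A') :
    R.e (x ≫ R.pre f B) = mapL P.Φ X f B (R.e x) := by
  rw [e_comp, e_pre, mapM_mapL, mapM_univ]

@[simp] lemma e_comp_post {X : M} {A B B' : P.carrier} (x : X ⟶ R.H A B) (f : B ⟶ B') :
    R.e (x ≫ R.post A f) = mapR P.Φ X A f (R.e x) := by
  rw [e_comp, e_post, mapM_mapR, mapM_univ]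

@[simp] lemma e_whiskerLeft_comp {X : M} {A B C : P.carrier} (x : X ⟶ R.H A B) :
    R.e (R.H B C ◁ x ≫ R.comp A B C) = P.mul _ _ A B C (R.univ B C) (R.e x) := by
  rw [e_comp, e_comp', ← P.mul_natural_X, mapM_univ]

@[simp] lemma e_whiskerRight_comp {Y : M} {A B C : P.carrier} (y : Y ⟶ R.H B C) :
    R.e (y ▷ R.H A B ≫ R.comp A B C) = P.mul _ _ A B C (R.e y) (R.univ A B) := by
  rw [e_comp, e_comp', ← P.mul_natural_Y, mapM_univ]

/-- Holds on universal elements by the definition of `comp`; naturality of `mul` in both variables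
of `M` extends it to all pairs. It makes the comparison `iso` multiplicative. -/
lemma e_tensorHom_comp {X Y : M} {A B C : P.carrier} (y : Y ⟶ R.H B C) (x : X ⟶ R.H A B) :
    R.e ((y ⊗ₘ x) ≫ R.comp A B C) = P.mul _ _ A B C (R.e y) (R.e x) := by
  rw [e_comp, e_comp', MonoidalCategory.tensorHom_def, ← mapM_univ, ← mapM_univ, P.mul_natural_Y,
    P.mul_natural_X]
  simp [mapM]

/-- This and the laws up to `comp_assoc` are the images under `e` of the corresponding properties of
`Φ` and `mul`, taken at universal elements and, for the unit laws, at `P.unit`. -/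
lemma post_pre {A A' B B' : P.carrier} (f : A ⟶ A') (g : B ⟶ B') :
    R.post A' g ≫ R.pre f B' = R.pre f B ≫ R.post A g :=
  R.ext (by rw [e_comp_pre, e_post, e_comp_post, e_pre, mapL_mapR])

lemma comp_natural_left {A A' : P.carrier} (f : A ⟶ A') (B C : P.carrier) :
    R.H B C ◁ R.pre f B ≫ R.comp A B C = R.comp A' B C ≫ R.pre f C :=
  R.ext (by simp [P.mul_natural_left])

lemma comp_natural_middle (A : P.carrier) {B B' : P.carrier} (f : B ⟶ B') (C : P.carrier) :
    R.H B' C ◁ R.post A f ≫ R.comp A B' C = R.pre f C ▷ R.H A B ≫ R.comp A B C :=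
  R.ext (by simp [P.mul_natural_middle])

lemma comp_natural_right (A B : P.carrier) {C C' : P.carrier} (f : C ⟶ C') :
    R.post B f ▷ R.H A B ≫ R.comp A B C' = R.comp A B C ≫ R.post A f :=
  R.ext (by simp [P.mul_natural_right])

lemma unit_comp (A B : P.carrier) :
    R.e.symm (P.unit B) ▷ R.H A B ≫ R.comp A B B = (λ_ (R.H A B)).hom :=
  R.ext (by simp [P.unit_mul])

lemma comp_unit (A B : P.carrier) :
    R.H A B ◁ R.e.symm (P.unit A) ≫ R.comp A A B = (ρ_ (R.H A B)).hom :=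
  R.ext (by simp [P.mul_unit])

lemma comp_assoc (A B C D : P.carrier) :
    R.comp B C D ▷ R.H A B ≫ R.comp A B D =
      (α_ (R.H C D) (R.H B C) (R.H A B)).hom ≫ R.H C D ◁ R.comp A B C ≫ R.comp A C D :=
  R.ext (by
    rw [e_whiskerRight_comp, R.e_comp (α_ (R.H C D) _ _).hom, e_whiskerLeft_comp, e_comp', e_comp',
      P.mul_assoc])

/-- The enrichment determined by representations of the functors `Φ_(-)(A, B)`. -/
def enrichment : Enrichment.{w} M where
  carrier := P.carrier
  hom :=
    { obj A :=
        { obj B := R.H A.unop B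
          map f := R.post A.unop f
          map_id B := R.ext (by simp)
          map_comp f g := R.ext (by simp [mapR_comp]) }
      map f :=
        { app B := R.pre f.unop B
          naturality B B' g := R.post_pre f.unop g }
      map_id A := by ext B; exact R.ext (by simp)
      map_comp f g := by ext B; exact R.ext (by simp [mapL_comp]) }
  j A := R.e.symm (P.unit A)
  comp := R.comp
  j_natural f := R.ext (by simp [Metatheory.post, Metatheory.pre, P.unit_natural])
  comp_natural_left := R.comp_natural_left
  comp_natural_middle := R.comp_natural_middle
  comp_natural_right := R.comp_natural_right
  id_comp := R.unit_comp
  comp_id := R.comp_unit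
  assoc := R.comp_assoc

/-- The metamodel of the reconstructed enrichment is the given one. -/
def iso : R.enrichment.toMetamodel ≅ P where
  hom :=
    { functor := 𝟭 _
      app _ _ _ f := R.e f
      natural_M p _ _ f := R.e_comp p f
      natural_left _ _ _ p _ f := R.e_comp_pre f p
      natural_right _ _ _ _ p f := R.e_comp_post f p
      app_unit A := R.e.apply_symm_apply (P.unit A)
      app_mul _ _ _ _ _ g f := R.e_tensorHom_comp g f }
  inv :=
    { functor := 𝟭 _
      app _ _ _ x := R.e.symm x
      natural_M p _ _ x := R.ext (by
        refine .trans ?_ (R.e_comp p (R.e.symm x)).symm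
        simp)
      -- Compatibilities of the inverse follow from those of `e`, since `e` is injective.
      natural_left _ _ _ p _ x := R.ext (by
        refine .trans ?_ (R.e_comp_pre (R.e.symm x) p).symm
        simp)
      natural_right _ _ _ _ p x := R.ext (by
        refine .trans ?_ (R.e_comp_post (R.e.symm x) p).symm
        simp)
      app_unit _ := rfl
      app_mul _ _ _ _ _ y x := R.ext (by
        refine .trans ?_ (R.e_tensorHom_comp (R.e.symm y) (R.e.symm x)).symm
        simp) }
  hom_inv_id := Metamodel.Hom.ext rfl (heq_of_eq (by
    funext X A B f; exact R.e.symm_apply_apply f))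
  inv_hom_id := Metamodel.Hom.ext rfl (heq_of_eq (by
    funext X A B x; exact R.e.apply_symm_apply x))

end HomRep

/-- A choice of representations of the functors `Φ_X(A, -)`. -/
structure ActRep (P : Metamodel.{w} M) where
  T : M → P.carrier → P.carrier
  e {X : M} {A B : P.carrier} : (T X A ⟶ B) ≃ val P.Φ X A B
  e_comp {X : M} {A B C : P.carrier} (f : T X A ⟶ B) (g : B ⟶ C) :
    e (f ≫ g) = mapR P.Φ X A g (e f)

namespace ActRep

variable {P : Metamodel.{w} M} (R : P.ActRep)

lemma ext {X : M} {A B : P.carrier} {f g : R.T X A ⟶ B} (h : R.e f = R.e g) : f = g :=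
  R.e.injective h

/-- The universal element of `Φ_X(A, -)`. -/
def univ (X : M) (A : P.carrier) : val P.Φ X A (R.T X A) := R.e (𝟙 _)

@[simp] lemma e_id (X : M) (A : P.carrier) : R.e (𝟙 (R.T X A)) = R.univ X A := rfl

@[simp] lemma mapR_univ {X : M} {A B : P.carrier} (f : R.T X A ⟶ B) :
    mapR P.Φ X A f (R.univ X A) = R.e f := by
  rw [univ, ← R.e_comp, Category.id_comp]

/-- The functoriality of `X ∗ A` in `X`. -/
def actL {X Y : M} (p : X ⟶ Y) (A : P.carrier) : R.T X A ⟶ R.T Y A :=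
  R.e.symm (mapM P.Φ p A _ (R.univ Y A))

/-- The functoriality of `X ∗ A` in `A`. -/
def actR (X : M) {A B : P.carrier} (f : A ⟶ B) : R.T X A ⟶ R.T X B :=
  R.e.symm (mapL P.Φ X f _ (R.univ X B))

/-- The counit of the action by representing objects. -/
def eps (A : P.carrier) : R.T (𝟙_ M) A ⟶ A := R.e.symm (P.unit A)

/-- The comultiplication of the action by representing objects. -/
def delta (X Y : M) (A : P.carrier) : R.T (Y ⊗ X) A ⟶ R.T Y (R.T X A) :=
  R.e.symm (P.mul X Y A _ _ (R.univ Y (R.T X A)) (R.univ X A))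

@[simp] lemma e_actL {X Y : M} (p : X ⟶ Y) (A : P.carrier) :
    R.e (R.actL p A) = mapM P.Φ p A _ (R.univ Y A) := R.e.apply_symm_apply _

@[simp] lemma e_actR (X : M) {A B : P.carrier} (f : A ⟶ B) :
    R.e (R.actR X f) = mapL P.Φ X f _ (R.univ X B) := R.e.apply_symm_apply _

@[simp] lemma e_eps (A : P.carrier) : R.e (R.eps A) = P.unit A := R.e.apply_symm_apply _

@[simp] lemma e_delta (X Y : M) (A : P.carrier) :
    R.e (R.delta X Y A) = P.mul X Y A _ _ (R.univ Y (R.T X A)) (R.univ X A) :=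
  R.e.apply_symm_apply _

@[simp] lemma e_actL_comp {X Y : M} (p : X ⟶ Y) {A B : P.carrier} (f : R.T Y A ⟶ B) :
    R.e (R.actL p A ≫ f) = mapM P.Φ p A B (R.e f) := by
  rw [e_comp, e_actL, ← mapM_mapR, mapR_univ]

@[simp] lemma e_actR_comp (X : M) {A B C : P.carrier} (f : A ⟶ B) (g : R.T X B ⟶ C) :
    R.e (R.actR X f ≫ g) = mapL P.Φ X f C (R.e g) := by
  rw [e_comp, e_actR, ← mapL_mapR, mapR_univ]

@[simp] lemma e_delta_comp {X Y : M} {A B : P.carrier} (g : R.T Y (R.T X A) ⟶ B) :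
    R.e (R.delta X Y A ≫ g) = P.mul X Y A _ B (R.e g) (R.univ X A) := by
  rw [e_comp, e_delta, ← P.mul_natural_right, mapR_univ]

/-- Dinaturality of `mul` in its middle variable moves `f` from the left factor to the right one,
where it turns the universal element into `e f`. This makes the comparison `iso` multiplicative. -/
lemma e_delta_actR_comp {X Y : M} {A B C : P.carrier} (f : R.T X A ⟶ B) (g : R.T Y B ⟶ C) :
    R.e (R.delta X Y A ≫ R.actR Y f ≫ g) = P.mul X Y A B C (R.e g) (R.e f) := by
  rw [e_delta_comp, e_actR_comp, ← P.mul_natural_middle, mapR_univ]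

lemma e_delta_actR {X Y : M} {A B : P.carrier} (f : R.T X A ⟶ B) :
    R.e (R.delta X Y A ≫ R.actR Y f) = P.mul X Y A B _ (R.univ Y B) (R.e f) := by
  rw [e_delta_comp, e_actR, ← P.mul_natural_middle, mapR_univ]

/-- As for enrichments, this and the laws up to `delta_assoc` are properties of `Φ`, `unit` and
`mul` read through `e`, now for morphisms out of `T X A`. -/
lemma actL_actR {X Y : M} (p : X ⟶ Y) {A B : P.carrier} (f : A ⟶ B) :
    R.actR X f ≫ R.actL p B = R.actL p A ≫ R.actR Y f :=
  R.ext (by rw [e_actL_comp, e_actR_comp, e_actL, e_actR, mapM_mapL])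

lemma eps_natural {A B : P.carrier} (f : A ⟶ B) : R.actR (𝟙_ M) f ≫ R.eps B = R.eps A ≫ f :=
  R.ext (by rw [e_actR_comp, e_eps, R.e_comp, e_eps, P.unit_natural])

lemma delta_natural_left {X X' : M} (p : X ⟶ X') (Y : M) (A : P.carrier) :
    R.actL (Y ◁ p) A ≫ R.delta X' Y A = R.delta X Y A ≫ R.actR Y (R.actL p A) :=
  R.ext (by rw [e_actL_comp, e_delta, e_delta_actR, e_actL, P.mul_natural_X])

lemma delta_natural_middle (X : M) {Y Y' : M} (p : Y ⟶ Y') (A : P.carrier) :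
    R.actL (p ▷ X) A ≫ R.delta X Y' A = R.delta X Y A ≫ R.actL p (R.T X A) :=
  R.ext (by rw [e_actL_comp, e_delta, e_delta_comp, e_actL, P.mul_natural_Y])

lemma delta_natural_right (X Y : M) {A B : P.carrier} (f : A ⟶ B) :
    R.actR (Y ⊗ X) f ≫ R.delta X Y B = R.delta X Y A ≫ R.actR Y (R.actR X f) :=
  R.ext (by rw [e_actR_comp, e_delta, e_delta_actR, e_actR, P.mul_natural_left])

lemma delta_unit_left (X : M) (A : P.carrier) :
    R.delta X (𝟙_ M) A ≫ R.eps (R.T X A) = R.actL (λ_ X).hom A :=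
  R.ext (by rw [e_delta_comp, e_eps, e_actL, P.unit_mul])

lemma delta_unit_right (X : M) (A : P.carrier) :
    R.delta (𝟙_ M) X A ≫ R.actR X (R.eps A) = R.actL (ρ_ X).hom A :=
  R.ext (by rw [e_delta_actR, e_eps, e_actL, P.mul_unit])

lemma delta_assoc (X Y Z : M) (A : P.carrier) :
    R.delta X (Z ⊗ Y) A ≫ R.delta Y Z (R.T X A) =
      R.actL (α_ Z Y X).hom A ≫ R.delta (Y ⊗ X) Z A ≫ R.actR Z (R.delta X Y A) :=
  R.ext (by rw [e_delta_comp, e_delta, e_actL_comp, e_delta_actR, e_delta, P.mul_assoc])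

/-- The oplax action determined by representations of the functors `Φ_X(A, -)`. -/
def oplaxAction : OplaxAction.{w} M where
  carrier := P.carrier
  T :=
    { obj X :=
        { obj A := R.T X A
          map f := R.actR X f
          map_id A := R.ext (by simp)
          map_comp f g := R.ext (by simp [mapL_comp]) }
      map p :=
        { app A := R.actL p A
          naturality A B f := R.actL_actR p f }
      map_id X := by ext A; exact R.ext (by simp [mapM])
      map_comp p q := by ext A; exact R.ext (by simp [mapM]) }
  eps := R.eps
  delta := R.delta
  eps_natural := R.eps_natural
  delta_natural_left := R.delta_natural_left
  delta_natural_middle := R.delta_natural_middle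
  delta_natural_right := R.delta_natural_right
  delta_unit_left := R.delta_unit_left
  delta_unit_right := R.delta_unit_right
  delta_assoc := R.delta_assoc

/-- The metamodel of the reconstructed oplax action is the given one. -/
def iso : R.oplaxAction.toMetamodel ≅ P where
  hom :=
    { functor := 𝟭 _
      app _ _ _ f := R.e f
      natural_M p _ _ f := R.e_actL_comp p f
      natural_left X _ _ p _ f := R.e_actR_comp X p f
      natural_right _ _ _ _ p f := R.e_comp f p
      app_unit A := R.e.apply_symm_apply (P.unit A)
      app_mul _ _ _ _ _ g f := R.e_delta_actR_comp f g }
  inv :=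
    { functor := 𝟭 _
      app _ _ _ x := R.e.symm x
      natural_M p _ _ x := R.ext (by
        refine .trans ?_ (R.e_actL_comp p (R.e.symm x)).symm
        simp)
      natural_left X _ _ p _ x := R.ext (by
        refine .trans ?_ (R.e_actR_comp X p (R.e.symm x)).symm
        simp)
      natural_right _ _ _ _ p x := R.ext (by
        refine .trans ?_ (R.e_comp (R.e.symm x) p).symm
        simp)
      app_unit _ := rfl
      app_mul _ _ _ _ _ y x := R.ext (by
        refine .trans ?_ (R.e_delta_actR_comp (R.e.symm x) (R.e.symm y)).symm
        simp) }
  hom_inv_id := Metamodel.Hom.ext rfl (heq_of_eq (by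
    funext X A B f; exact R.e.symm_apply_apply f))
  inv_hom_id := Metamodel.Hom.ext rfl (heq_of_eq (by
    funext X A B x; exact R.e.apply_symm_apply x))

end ActRep

end Metamodel

namespace Metamodel

/-! ### Isomorphisms of metamodels -/

section Iso

variable {P Q : Metamodel.{w} M}

/-- Stated for an arbitrary `F` with an equation, so that substitution handles the codomain of
`F.app`: it lies over the objects `F A` and `F B`, which equal `A` and `B` only through `h`. -/
lemma app_bijective_of_eq_id {F : P ⟶ P} (h : F = 𝟙 P) (X : M) (A B : P.carrier) :
    Function.Bijective (F.app X A B) := by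
  subst h
  exact Function.bijective_id

/-- Two-out-of-six: at objects in the image of `i.hom`, the component of `i.inv` is surjective by
`h₁` and injective by `h₂`, so it cancels from `h₁`. -/
lemma app_bijective (i : P ≅ Q) (X : M) (A B : P.carrier) :
    Function.Bijective (i.hom.app X A B) := by
  have h₁ (A B : P.carrier) : Function.Bijective
      (i.inv.app X (i.hom.functor.obj A) (i.hom.functor.obj B) ∘ i.hom.app X A B) :=
    app_bijective_of_eq_id i.hom_inv_id X A B
  have h₂ (A B : Q.carrier) : Function.Bijective
      (i.hom.app X (i.inv.functor.obj A) (i.inv.functor.obj B) ∘ i.inv.app X A B) :=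
    app_bijective_of_eq_id i.inv_hom_id X A B
  have h₃ : Function.Bijective
      (i.inv.app X (i.hom.functor.obj A) (i.hom.functor.obj B)) :=
    ⟨(h₂ _ _).1.of_comp, (h₁ A B).2.of_comp⟩
  exact (Function.Bijective.of_comp_iff' h₃ _).1 (h₁ A B)

/-- The equivalence of categories underlying an isomorphism of metamodels. -/
def equivalence (i : P ≅ Q) : P.carrier ≌ Q.carrier :=
  CategoryTheory.Equivalence.mk i.hom.functor i.inv.functor
    (eqToIso (congrArg Hom.functor i.hom_inv_id).symm)
    (eqToIso (congrArg Hom.functor i.inv_hom_id))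

/-- Birepresentability is invariant under isomorphism. -/
lemma IsBirepresentable.of_iso (i : P ≅ Q) (hQ : Q.IsBirepresentable) : P.IsBirepresentable := by
  intro X A B
  have h := hQ X (i.hom.functor.obj A) (i.hom.functor.obj B)
  constructor
  · have := h.1
    -- With `A` and `B` fixed only the variable of `M` moves, so the representing object is
    -- unchanged.
    let e : (P.Φ.flip.obj (op A)).flip.obj B ≅
        (Q.Φ.flip.obj (op (i.hom.functor.obj A))).flip.obj (i.hom.functor.obj B) :=
      NatIso.ofComponents
        (fun Y => (Equiv.ofBijective _ (app_bijective i Y.unop A B)).toIso)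
        (fun p => by ext x; exact i.hom.natural_M p.unop A B x)
    exact (((Q.Φ.flip.obj (op (i.hom.functor.obj A))).flip.obj
      (i.hom.functor.obj B)).representableBy.ofIso e.symm).isRepresentable
  · have := h.2
    let K := (Q.Φ.obj (op X)).obj (op (i.hom.functor.obj A))
    let e : (P.Φ.obj (op X)).obj (op A) ≅ i.hom.functor ⋙ K :=
      NatIso.ofComponents
        (fun C => (Equiv.ofBijective _ (app_bijective i X A C)).toIso)
        (fun p => by ext x; exact i.hom.natural_right X A p x)
    -- Here the target variable is moved by `i.hom`; since `i.inv` is left adjoint to it, the image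
    -- under `i.inv` of the object corepresenting `K` corepresents the composite.
    let e' : (P.Φ.obj (op X)).obj (op A) ≅ i.hom.functor ⋙ coyoneda.obj (op K.coreprX) :=
      e ≪≫ Functor.isoWhiskerLeft _ K.coreprW.symm
    exact (((equivalence i).symm.toAdjunction.corepresentableBy
      K.coreprX).ofIso e'.symm).isCorepresentable

end Iso

/-- Representations of the functors `Φ_(-)(A, B)` of a birepresentable metamodel. -/
noncomputable def IsBirepresentable.homRep {P : Metamodel.{w} M} (h : P.IsBirepresentable) :
    P.HomRep :=
  -- This half of the condition does not involve `X`; the unit object only fills the slot.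
  have (A B : P.carrier) : ((P.Φ.flip.obj (op A)).flip.obj B).IsRepresentable := (h (𝟙_ M) A B).1
  { H A B := ((P.Φ.flip.obj (op A)).flip.obj B).reprX
    e {_ A B} := ((P.Φ.flip.obj (op A)).flip.obj B).representableBy.homEquiv
    e_comp {_ _ A B} := ((P.Φ.flip.obj (op A)).flip.obj B).representableBy.homEquiv_comp }

/-- Representations of the functors `Φ_X(A, -)` of a birepresentable metamodel. -/
noncomputable def IsBirepresentable.actRep {P : Metamodel.{w} M} (h : P.IsBirepresentable) :
    P.ActRep :=
  have (X : M) (A : P.carrier) : ((P.Φ.obj (op X)).obj (op A)).IsCorepresentable := (h X A A).2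
  { T X A := ((P.Φ.obj (op X)).obj (op A)).coreprX
    e {X A _} := ((P.Φ.obj (op X)).obj (op A)).corepresentableBy.homEquiv
    e_comp {X A _ _} f g := ((P.Φ.obj (op X)).obj (op A)).corepresentableBy.homEquiv_comp g f }

end Metamodel

/-! ### Adjointness as birepresentability, and the essential images. -/

lemma Enrichment.isBirepresentable_iff (E : Enrichment.{w} M) :
    E.toMetamodel.IsBirepresentable ↔
      ∀ A : E.carrier, (E.hom.obj (op A)).IsRightAdjoint := by
  refine ⟨fun h A => ?_, fun h X A B => ⟨?_, ?_⟩⟩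
  -- A left adjoint exists once its value at each `X` does, that is, once `M(X, ⟨A, -⟩)` is
  -- corepresentable. The second `A` passed to `h` is a filler.
  · apply Functor.isRightAdjoint_of_leftAdjointObjIsDefined_eq_top
    ext X
    exact iff_of_true (h X A A).2 trivial
  -- Automatic for every enrichment: `⟨A, B⟩` is a representing object.
  · exact (Functor.RepresentableBy.yoneda (ev E.hom A B)).isRepresentable
  · have := h A
    exact ((Adjunction.ofIsRightAdjoint (E.hom.obj (op A))).corepresentableBy X).isCorepresentable

lemma OplaxAction.isBirepresentable_iff (E : OplaxAction.{w} M) :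
    E.toMetamodel.IsBirepresentable ↔
      ∀ A : E.carrier, (E.T.flip.obj A).IsLeftAdjoint := by
  refine ⟨fun h A => ?_, fun h X A B => ⟨?_, ?_⟩⟩
  -- Dually, the right adjoint of `- ∗ A` at `B` is an object representing `C(- ∗ A, B)`.
  · apply Functor.isLeftAdjoint_of_rightAdjointObjIsDefined_eq_top
    ext B
    exact iff_of_true (h (𝟙_ M) A B).1 trivial
  · have := h A
    exact ((Adjunction.ofIsLeftAdjoint (E.T.flip.obj A)).representableBy B).isRepresentable
  · exact (Functor.CorepresentableBy.coyoneda (op (act E.T X A))).isCorepresentable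

/-- The enrichment reconstructed from a birepresentable metamodel. -/
noncomputable def Metamodel.IsBirepresentable.enrichmentR {P : Metamodel.{w} M}
    (h : P.IsBirepresentable) : EnrichmentR.{w} M :=
  -- The left adjoints need no construction: the metamodel of the reconstruction is isomorphic to
  -- `P`, hence birepresentable.
  (⟨h.homRep.enrichment, (Enrichment.isBirepresentable_iff _).1 (h.of_iso h.homRep.iso)⟩ :
    {E : Enrichment.{w} M // ∀ A : E.carrier, (E.hom.obj (op A)).IsRightAdjoint})

/-- The oplax action reconstructed from a birepresentable metamodel. -/
noncomputable def Metamodel.IsBirepresentable.oplaxActionL {P : Metamodel.{w} M}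
    (h : P.IsBirepresentable) : OplaxActionL.{w} M :=
  (⟨h.actRep.oplaxAction, (OplaxAction.isBirepresentable_iff _).1 (h.of_iso h.actRep.iso)⟩ :
    {E : OplaxAction.{w} M // ∀ A : E.carrier, (E.T.flip.obj A).IsLeftAdjoint})

lemma inEssImage_enrichmentREmbedding_iff (P : Metamodel.{w} M) :
    InEssImage (enrichmentREmbedding.{w} M) P ↔ P.IsBirepresentable :=
  ⟨fun ⟨E, ⟨i⟩⟩ => .of_iso i.symm ((Enrichment.isBirepresentable_iff E.1).2 E.2),
    fun h => ⟨h.enrichmentR, ⟨h.homRep.iso⟩⟩⟩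

lemma inEssImage_oplaxActionLEmbedding_iff (P : Metamodel.{w} M) :
    InEssImage (oplaxActionLEmbedding.{w} M) P ↔ P.IsBirepresentable :=
  ⟨fun ⟨E, ⟨i⟩⟩ => .of_iso i.symm ((OplaxAction.isBirepresentable_iff E.1).2 E.2),
    fun h => ⟨h.oplaxActionL, ⟨h.actRep.iso⟩⟩⟩

/-! ### The equivalence of 2-categories -/

open Bicategory

namespace Enrichment

@[simp] lemma mapHom_ofHom {E E' : Enrichment.{w} M} (H : E.toMetamodel ⟶ E'.toMetamodel) :
    mapHom (ofHom H) = H := (homEquiv E E').right_inv H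

/-- Lets equations of 1-cells be checked between metamodels, where the comparison isomorphisms are
available and cancel. -/
lemma mapHom_injective {E E' : Enrichment.{w} M} {F G : E ⟶ E'} (h : mapHom F = mapHom G) :
    F = G := (homEquiv E E').injective h

/-- The action of `ofHom` on 2-cells. -/
def ofHomMap₂ {E E' : Enrichment.{w} M} {H K : E.toMetamodel ⟶ E'.toMetamodel} (θ : H ⟶ K) :
    ofHom H ⟶ ofHom K where
  nat := θ.nat
  comm A B := θ.comm _ A B (𝟙 (ev E.hom A B))

end Enrichment

namespace OplaxAction

@[simp] lemma mapHom_ofHom {E E' : OplaxAction.{w} M} (H : E.toMetamodel ⟶ E'.toMetamodel) :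
    mapHom (ofHom H) = H := (homEquiv E E').right_inv H

lemma mapHom_injective {E E' : OplaxAction.{w} M} {F G : E ⟶ E'} (h : mapHom F = mapHom G) :
    F = G := (homEquiv E E').injective h

/-- The action of `ofHom` on 2-cells. -/
def ofHomMap₂ {E E' : OplaxAction.{w} M} {H K : E.toMetamodel ⟶ E'.toMetamodel} (θ : H ⟶ K) :
    ofHom H ⟶ ofHom K where
  nat := θ.nat
  comm X A := θ.comm X A _ (𝟙 (act E.T X A))

end OplaxAction

/-! ### From enrichments to oplax actions. -/

namespace EnrichmentR

lemma isBirepresentable (E : EnrichmentR.{w} M) : E.1.toMetamodel.IsBirepresentable :=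
  (Enrichment.isBirepresentable_iff E.1).2 E.2

/-- Isomorphisms of enrichments from isomorphisms of the associated metamodels. -/
def isoMk {E E' : EnrichmentR.{w} M} (i : E.1.toMetamodel ≅ E'.1.toMetamodel) : E ≅ E' where
  hom := InducedBicategory.mkHom (Enrichment.ofHom i.hom)
  inv := InducedBicategory.mkHom (Enrichment.ofHom i.inv)
  hom_inv_id := InducedBicategory.hom_ext (Enrichment.mapHom_injective (by
    refine (Enrichment.mapHom_comp _ _).trans ?_
    rw [Enrichment.mapHom_ofHom, Enrichment.mapHom_ofHom, i.hom_inv_id]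
    exact (Enrichment.mapHom_id _).symm))
  inv_hom_id := InducedBicategory.hom_ext (Enrichment.mapHom_injective (by
    refine (Enrichment.mapHom_comp _ _).trans ?_
    rw [Enrichment.mapHom_ofHom, Enrichment.mapHom_ofHom, i.inv_hom_id]
    exact (Enrichment.mapHom_id _).symm))

/-- The oplax action with the same metamodel as a given enrichment. -/
noncomputable def toAction (E : EnrichmentR.{w} M) : OplaxActionL.{w} M :=
  E.isBirepresentable.oplaxActionL

/-- The comparison of the metamodels of `E.toAction` and `E`. -/
noncomputable def toActionIso (E : EnrichmentR.{w} M) :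
    E.toAction.1.toMetamodel ≅ E.1.toMetamodel :=
  E.isBirepresentable.actRep.iso

/-- The action of `toAction` on 1-cells. -/
noncomputable def toActionMap {E E' : EnrichmentR.{w} M} (F : E ⟶ E') :
    E.toAction.1 ⟶ E'.toAction.1 :=
  OplaxAction.ofHom (E.toActionIso.hom ≫ Enrichment.mapHom F.hom ≫ E'.toActionIso.inv)

/-- The 1-cell is characterised as a conjugate in metamodels; functoriality follows because adjacent
comparison isomorphisms cancel. -/
lemma mapHom_toActionMap {E E' : EnrichmentR.{w} M} (F : E ⟶ E') :
    OplaxAction.mapHom (toActionMap F) =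
      E.toActionIso.hom ≫ Enrichment.mapHom F.hom ≫ E'.toActionIso.inv :=
  OplaxAction.mapHom_ofHom _

/-- The 2-functor from enrichments to oplax actions. -/
noncomputable def toActionFunctor :
    StrictPseudofunctor (EnrichmentR.{w} M) (OplaxActionL.{w} M) :=
  StrictPseudofunctor.mk''
    { obj := toAction
      map := fun F => InducedBicategory.mkHom (toActionMap F)
      -- The whiskering 1-cells have identity underlying functors, so the natural transformation
      -- keeps its components.
      map₂ := fun {E E' _ _} η => ⟨OplaxAction.ofHomMap₂
        (E.toActionIso.hom ◁ (Enrichment.mapHom₂ η.hom ▷ E'.toActionIso.inv))⟩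
      map₂_id := fun _ => rfl
      map₂_comp := fun _ _ => rfl
      map_id := fun E => InducedBicategory.hom_ext (OplaxAction.mapHom_injective (by
        refine (mapHom_toActionMap _).trans (.trans ?_ (OplaxAction.mapHom_id _).symm)
        have h : Enrichment.mapHom (InducedBicategory.Hom.hom (𝟙 E)) = 𝟙 E.1.toMetamodel :=
          Enrichment.mapHom_id _
        rw [h, Category.id_comp, Iso.hom_inv_id]))
      map_comp := fun F G => InducedBicategory.hom_ext (OplaxAction.mapHom_injective (by
        refine (mapHom_toActionMap _).trans (.trans ?_ (OplaxAction.mapHom_comp _ _).symm)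
        have h : Enrichment.mapHom (InducedBicategory.Hom.hom (F ≫ G)) =
          Enrichment.mapHom F.hom ≫ Enrichment.mapHom G.hom := Enrichment.mapHom_comp _ _
        rw [h, mapHom_toActionMap, mapHom_toActionMap]
        simp only [Category.assoc, Iso.inv_hom_id_assoc]))
      map₂_whisker_left := fun F G K η => by
        apply InducedBicategory.hom₂_ext
        apply OplaxAction.hom₂_ext
        intro A
        simp only [InducedBicategory.Hom.category_comp_hom, InducedBicategory.eqToHom_hom,
          OplaxAction.comp_nat, NatTrans.comp_app, OplaxAction.eqToHom_nat_app]
        -- The 1-cells related by `eqToHom` have definitionally equal underlying functors, so these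
        -- components are identities.
        erw [Category.comp_id, Category.id_comp]
        rfl
      map₂_whisker_right := fun η K => by
        apply InducedBicategory.hom₂_ext
        apply OplaxAction.hom₂_ext
        intro A
        simp only [InducedBicategory.Hom.category_comp_hom, InducedBicategory.eqToHom_hom,
          OplaxAction.comp_nat, NatTrans.comp_app, OplaxAction.eqToHom_nat_app]
        erw [Category.comp_id, Category.id_comp]
        rfl }

end EnrichmentR

/-! ### From oplax actions to enrichments. -/

namespace OplaxActionL

lemma isBirepresentable (E : OplaxActionL.{w} M) : E.1.toMetamodel.IsBirepresentable :=
  (OplaxAction.isBirepresentable_iff E.1).2 E.2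

/-- Isomorphisms of oplax actions from isomorphisms of the associated metamodels. -/
def isoMk {E E' : OplaxActionL.{w} M} (i : E.1.toMetamodel ≅ E'.1.toMetamodel) : E ≅ E' where
  hom := InducedBicategory.mkHom (OplaxAction.ofHom i.hom)
  inv := InducedBicategory.mkHom (OplaxAction.ofHom i.inv)
  hom_inv_id := InducedBicategory.hom_ext (OplaxAction.mapHom_injective (by
    refine (OplaxAction.mapHom_comp _ _).trans ?_
    rw [OplaxAction.mapHom_ofHom, OplaxAction.mapHom_ofHom, i.hom_inv_id]
    exact (OplaxAction.mapHom_id _).symm))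
  inv_hom_id := InducedBicategory.hom_ext (OplaxAction.mapHom_injective (by
    refine (OplaxAction.mapHom_comp _ _).trans ?_
    rw [OplaxAction.mapHom_ofHom, OplaxAction.mapHom_ofHom, i.inv_hom_id]
    exact (OplaxAction.mapHom_id _).symm))

/-- The enrichment with the same metamodel as a given oplax action. -/
noncomputable def toEnrichment (E : OplaxActionL.{w} M) : EnrichmentR.{w} M :=
  E.isBirepresentable.enrichmentR

/-- The comparison of the metamodels of `E.toEnrichment` and `E`. -/
noncomputable def toEnrichmentIso (E : OplaxActionL.{w} M) :
    E.toEnrichment.1.toMetamodel ≅ E.1.toMetamodel :=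
  E.isBirepresentable.homRep.iso

/-- The action of `toEnrichment` on 1-cells. -/
noncomputable def toEnrichmentMap {E E' : OplaxActionL.{w} M} (F : E ⟶ E') :
    E.toEnrichment.1 ⟶ E'.toEnrichment.1 :=
  Enrichment.ofHom (E.toEnrichmentIso.hom ≫ OplaxAction.mapHom F.hom ≫ E'.toEnrichmentIso.inv)

lemma mapHom_toEnrichmentMap {E E' : OplaxActionL.{w} M} (F : E ⟶ E') :
    Enrichment.mapHom (toEnrichmentMap F) =
      E.toEnrichmentIso.hom ≫ OplaxAction.mapHom F.hom ≫ E'.toEnrichmentIso.inv :=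
  Enrichment.mapHom_ofHom _

/-- The 2-functor from oplax actions to enrichments. -/
noncomputable def toEnrichmentFunctor :
    StrictPseudofunctor (OplaxActionL.{w} M) (EnrichmentR.{w} M) :=
  StrictPseudofunctor.mk''
    { obj := toEnrichment
      map := fun F => InducedBicategory.mkHom (toEnrichmentMap F)
      map₂ := fun {E E' _ _} η => ⟨Enrichment.ofHomMap₂
        (E.toEnrichmentIso.hom ◁ (OplaxAction.mapHom₂ η.hom ▷ E'.toEnrichmentIso.inv))⟩
      map₂_id := fun _ => rfl
      map₂_comp := fun _ _ => rfl
      map_id := fun E => InducedBicategory.hom_ext (Enrichment.mapHom_injective (by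
        refine (mapHom_toEnrichmentMap _).trans (.trans ?_ (Enrichment.mapHom_id _).symm)
        have h : OplaxAction.mapHom (InducedBicategory.Hom.hom (𝟙 E)) = 𝟙 E.1.toMetamodel :=
          OplaxAction.mapHom_id _
        rw [h, Category.id_comp, Iso.hom_inv_id]))
      map_comp := fun F G => InducedBicategory.hom_ext (Enrichment.mapHom_injective (by
        refine (mapHom_toEnrichmentMap _).trans (.trans ?_ (Enrichment.mapHom_comp _ _).symm)
        have h : OplaxAction.mapHom (InducedBicategory.Hom.hom (F ≫ G)) =
          OplaxAction.mapHom F.hom ≫ OplaxAction.mapHom G.hom := OplaxAction.mapHom_comp _ _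
        rw [h, mapHom_toEnrichmentMap, mapHom_toEnrichmentMap]
        simp only [Category.assoc, Iso.inv_hom_id_assoc]))
      map₂_whisker_left := fun F G K η => by
        apply InducedBicategory.hom₂_ext
        apply Enrichment.hom₂_ext
        intro A
        simp only [InducedBicategory.Hom.category_comp_hom, InducedBicategory.eqToHom_hom,
          Enrichment.comp_nat, NatTrans.comp_app, Enrichment.eqToHom_nat_app]
        erw [Category.comp_id, Category.id_comp]
        rfl
      map₂_whisker_right := fun η K => by
        apply InducedBicategory.hom₂_ext
        apply Enrichment.hom₂_ext
        intro A
        simp only [InducedBicategory.Hom.category_comp_hom, InducedBicategory.eqToHom_hom,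
          Enrichment.comp_nat, NatTrans.comp_app, Enrichment.eqToHom_nat_app]
        erw [Category.comp_id, Category.id_comp]
        rfl }

end OplaxActionL

/-- The unit of the equivalence between enrichments and oplax actions. -/
noncomputable def enrichmentUnitIso : TwoNatIso (StrictPseudofunctor.id (EnrichmentR.{w} M))
    (EnrichmentR.toActionFunctor.comp OplaxActionL.toEnrichmentFunctor) where
  app E := EnrichmentR.isoMk (E.toActionIso.symm ≪≫ E.toAction.toEnrichmentIso.symm)
  naturality {E E'} F := InducedBicategory.hom_ext (Enrichment.mapHom_injective (by
    refine (Enrichment.mapHom_comp _ _).trans (.trans ?_ (Enrichment.mapHom_comp _ _).symm)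
    -- The round trip conjugates `F` twice, by exactly the two isomorphisms that make up `app`, so
    -- naturality is cancellation.
    have h₁ := OplaxActionL.mapHom_toEnrichmentMap (E := E.toAction) (E' := E'.toAction)
      (InducedBicategory.mkHom (EnrichmentR.toActionMap F))
    rw [EnrichmentR.mapHom_toActionMap] at h₁
    refine (congrArg (_ ≫ ·) (Enrichment.mapHom_ofHom _)).trans (.trans ?_
      (congr (congrArg (· ≫ ·) (Enrichment.mapHom_ofHom _)) h₁).symm)
    change Enrichment.mapHom F.hom ≫ E'.toActionIso.inv ≫ E'.toAction.toEnrichmentIso.inv =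
      (E.toActionIso.inv ≫ E.toAction.toEnrichmentIso.inv) ≫ E.toAction.toEnrichmentIso.hom ≫
        (E.toActionIso.hom ≫ Enrichment.mapHom F.hom ≫ E'.toActionIso.inv) ≫
          E'.toAction.toEnrichmentIso.inv
    simp only [Category.assoc, Iso.inv_hom_id_assoc]))
  naturality₂ η := by
    apply InducedBicategory.hom₂_ext
    apply Enrichment.hom₂_ext
    intro A
    simp only [InducedBicategory.Hom.category_comp_hom, InducedBicategory.eqToHom_hom,
      Enrichment.comp_nat, NatTrans.comp_app, Enrichment.eqToHom_nat_app]
    erw [Category.comp_id, Category.id_comp]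
    rfl

/-- The counit of the equivalence between enrichments and oplax actions. -/
noncomputable def oplaxActionCounitIso :
    TwoNatIso (OplaxActionL.toEnrichmentFunctor.comp EnrichmentR.toActionFunctor)
      (StrictPseudofunctor.id (OplaxActionL.{w} M)) where
  app E := OplaxActionL.isoMk (E.toEnrichment.toActionIso ≪≫ E.toEnrichmentIso)
  naturality {E E'} F := InducedBicategory.hom_ext (OplaxAction.mapHom_injective (by
    refine (OplaxAction.mapHom_comp _ _).trans (.trans ?_ (OplaxAction.mapHom_comp _ _).symm)
    have h₁ := EnrichmentR.mapHom_toActionMap (E := E.toEnrichment) (E' := E'.toEnrichment)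
      (InducedBicategory.mkHom (OplaxActionL.toEnrichmentMap F))
    rw [OplaxActionL.mapHom_toEnrichmentMap] at h₁
    refine (congr (congrArg (· ≫ ·) h₁) (OplaxAction.mapHom_ofHom _)).trans (.trans ?_
      (congrArg (· ≫ _) (OplaxAction.mapHom_ofHom _)).symm)
    change (E.toEnrichment.toActionIso.hom ≫
      (E.toEnrichmentIso.hom ≫ OplaxAction.mapHom F.hom ≫ E'.toEnrichmentIso.inv) ≫
        E'.toEnrichment.toActionIso.inv) ≫ E'.toEnrichment.toActionIso.hom ≫
          E'.toEnrichmentIso.hom =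
      (E.toEnrichment.toActionIso.hom ≫ E.toEnrichmentIso.hom) ≫ OplaxAction.mapHom F.hom
    simp only [Category.assoc, Iso.inv_hom_id_assoc, Iso.inv_hom_id, Category.comp_id]))
  naturality₂ η := by
    apply InducedBicategory.hom₂_ext
    apply OplaxAction.hom₂_ext
    intro A
    simp only [InducedBicategory.Hom.category_comp_hom, InducedBicategory.eqToHom_hom,
      OplaxAction.comp_nat, NatTrans.comp_app, OplaxAction.eqToHom_nat_app]
    symm
    exact (Category.id_comp _).trans (Category.comp_id _)

variable (M) in
/-- The 2-categories of right adjoint enrichments and of left adjoint oplax actions are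
equivalent. -/
noncomputable def enrichmentActionEquivalence :
    TwoEquivalence (EnrichmentR.{w} M) (OplaxActionL.{w} M) where
  functor := EnrichmentR.toActionFunctor
  inverse := OplaxActionL.toEnrichmentFunctor
  unitIso := enrichmentUnitIso
  counitIso := oplaxActionCounitIso

end Metatheory

/-- The coincidence of the essential images is expressed by giving both the same criterion. -/
theorem mainTheorem7 (M : Type u) [Category.{v} M] [MonoidalCategory M] :
    (Metatheory.IsFullyFaithful (Metatheory.enrichmentREmbedding.{w} M) ∧
      Metatheory.IsFullyFaithful (Metatheory.oplaxActionLEmbedding.{w} M) ∧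
      ∀ P : Metatheory.Metamodel.{w} M,
        (Metatheory.InEssImage (Metatheory.enrichmentREmbedding.{w} M) P ↔
          P.IsBirepresentable) ∧
        (Metatheory.InEssImage (Metatheory.oplaxActionLEmbedding.{w} M) P ↔
          P.IsBirepresentable)) ∧
    Nonempty (Metatheory.TwoEquivalence (Metatheory.EnrichmentR.{w} M)
      (Metatheory.OplaxActionL.{w} M)) :=
  ⟨⟨Metatheory.Enrichment.isFullyFaithful_toMetamodelFunctor.restrict _,
    Metatheory.OplaxAction.isFullyFaithful_toMetamodelFunctor.restrict _,
    fun P => ⟨Metatheory.inEssImage_enrichmentREmbedding_iff P,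
      Metatheory.inEssImage_oplaxActionLEmbedding_iff P⟩⟩,
    ⟨Metatheory.enrichmentActionEquivalence M⟩⟩
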